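/- Let $N,K\ge 1$ be integers, $X=\mathbb R^K$ with the Euclidean norm, and let $\Phi_1,\dots,\Phi_N:X\to\mathbb R$ be continuously differentiable with $L$-Lipschitz gradients and strongly convex with a common constant $\kappa>0$, i.e. $\langle x-y,\nabla\Phi_j(x)-\nabla\Phi_j(y)\rangle\ge\kappa\|x-y\|^2$ for all $x,y\in X$ and all $j$. Put $\bar\Phi=\frac1N\sum_{j=1}^N\Phi_j$. Let $(i(t))_{t\ge0}$ be a (càdlàg) continuous-time Markov process on $\{1,\dots,N\}$, on a probability space $(\Omega,\mathcal F,\mathbb P)$, with uniform initial distribution and transition rate matrix $\Gamma_N-N\gamma\,\mathrm{Id}_N$, where $\gamma>0$ and all entries of the $N\times N$ matrix $\Gamma_N$ equal $\gamma$. Let $\mu:[0,\infty)\to(0,\infty)$ be non-decreasing and continuously differentiable with $\mu(t)\to\infty$ as $t\to\infty$ (the learning rate $1/\mu$ decreases to $0$), and put $\beta(t)=\int_0^t\mu(s)\,ds$ and $i^\beta(t)=i(\beta(t))$. Let $m:[0,\infty)\to(0,\infty)$ be strictly decreasing and differentiable with $m(t)\to0$ as $t\to\infty$, $m(0)\le1$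 and $|m'(t)|\le\lambda\,m(t)$ for all $t>0$, where $\lambda=\min\{\kappa/4,1/4\}$. Let $\tau^\beta_0=0$ and let $\tau^\beta_1<\tau^\beta_2<\dots$ be the jump times of $(i^\beta(t))_{t\ge0}$. Assume that there are $\alpha_1,\alpha_2,\alpha_3>0$ such that $$\lim_{k\to\infty}\mathbb P\Big(\bigcap_{n\ge k}\Big\{\tfrac{\kappa}{2\mu(\tau^\beta_{n+1})}\ge\tfrac{\alpha_1}{\sqrt n}\ \text{ and }\ m(\tau^\beta_n)\le\alpha_2e^{-\alpha_3\sqrt n}\Big\}\Big)=1$$ (if $N=1$ there are no jumps and this condition is void). Let $(q_t,p_t)_{t\ge0}$ be the decreasing-mass, decreasing-learning-rate stochastic gradient-momentum process (ddSGMP), i.e. the process with continuous paths solving $$dq_t=p_t\,dt,\qquad m(t)\,dp_t=-\nabla\Phi_{i^\beta(t)}(q_t)\,dt-p_t\,dt,\qquad q_{t=0}=q_0,\quad p_{t=0}=p_0,$$ with deterministic initial values $q_0,p_0\in X$. Then $\bar\Phi$ has a unique minimiser $\theta_*$ and $\|q_t-\theta_*\|\to0$ in probability as $t\to\infty$. 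-/

import Mathlib

open MeasureTheory Filter Topology Set
open scoped NNReal Gradient

noncomputable section

namespace SGMP

/-- The state space `ℝ^K` with the Euclidean norm. -/
abbrev X (K : ℕ) : Type := EuclideanSpace ℝ (Fin K)

/-- The full target function, the average of the potentials. -/
def avgPotential {N K : ℕ} (Φ : Fin N → X K → ℝ) (x : X K) : ℝ :=
  (1 / (N : ℝ)) * ∑ i, Φ i x

/-- `f` is continuously differentiable with `L`-Lipschitz gradient. -/
def IsC1LipschitzGradient {K : ℕ} (L : ℝ≥0) (f : X K → ℝ) : Prop :=
  ContDiff ℝ 1 f ∧ LipschitzWith L (∇ f)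

/-- Strong convexity of a differentiable function with convexity parameter `κ`. -/
def IsStronglyConvexWith {K : ℕ} (κ : ℝ) (f : X K → ℝ) : Prop :=
  ∀ x y : X K, κ * ‖x - y‖ ^ 2 ≤ inner ℝ (x - y) (∇ f x - ∇ f y)

/-- The transition rate matrix `Γ_N - N γ I_N`, where every entry of `Γ_N` is `γ`. -/
def rateMatrix (N : ℕ) (γ : ℝ) : Matrix (Fin N) (Fin N) ℝ :=
  Matrix.of (fun _ _ => γ) - ((N : ℝ) * γ) • (1 : Matrix (Fin N) (Fin N) ℝ)

/-- `i` is a continuous-time Markov process on `Fin N`, indexed by times `t ≥ 0`, with transition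
rate matrix `rateMatrix N γ` and uniform initial distribution: its paths are almost surely
right-continuous with left limits (for the discrete topology), and its finite-dimensional
distributions are those of the Markov chain with transition semigroup `exp (t A)`. -/
structure IsIndexProcess {Ω : Type*} [MeasurableSpace Ω] (P : Measure Ω) {N : ℕ} (γ : ℝ)
    (i : ℝ → Ω → Fin N) : Prop where
  measurable : ∀ t, 0 ≤ t → Measurable (i t)
  right_cont : ∀ᵐ ω ∂P, ∀ t, 0 ≤ t → ∀ᶠ s in 𝓝[>] t, i s ω = i t ω
  left_lim : ∀ᵐ ω ∂P, ∀ t, 0 < t → ∃ j, ∀ᶠ s in 𝓝[<] t, i s ω = j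
  law : ∀ (n : ℕ) (t : Fin (n + 1) → ℝ), t 0 = 0 → Monotone t → ∀ j : Fin (n + 1) → Fin N,
    P.real {ω | ∀ k, i (t k) ω = j k} =
      (1 / (N : ℝ)) * ∏ k : Fin n,
        NormedSpace.exp ((t k.succ - t k.castSucc) • rateMatrix N γ) (j k.castSucc) (j k.succ)

/-- The time change `β(t) = ∫₀ᵗ μ(s) ds`. -/
def timeChange (μ : ℝ → ℝ) (t : ℝ) : ℝ := ∫ s in (0 : ℝ)..t, μ s

/-- The rescaled index process `i^β(t) = i(β(t))`. -/
def rescaled {Ω : Type*} {N : ℕ} (μ : ℝ → ℝ) (i : ℝ → Ω → Fin N) (t : ℝ) (ω : Ω) : Fin N :=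
  i (timeChange μ t) ω

/-- The successive jump times of a path `x` on `[0, ∞)`, started at `0`; the value `⊤` means that
there is no further jump. -/
def jumpTime {S : Type*} (x : ℝ → S) : ℕ → EReal
  | 0 => 0
  | n + 1 => sInf ((fun t : ℝ => (t : EReal)) ''
      {t : ℝ | jumpTime x n < (t : EReal) ∧ x t ≠ x (jumpTime x n).toReal})

/-- The event that `κ / (2 μ(τ_{n+1})) ≥ α₁ / √n` and `m(τ_n) ≤ α₂ exp (-α₃ √n)`, where `τ_n` are
the jump times of the rescaled index process. A condition at a jump time that does not exist
(which has positive probability only if `N = 1`) is void. -/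
def growthEvent {Ω : Type*} {N : ℕ} (κ α₁ α₂ α₃ : ℝ) (m μ : ℝ → ℝ) (i : ℝ → Ω → Fin N)
    (n : ℕ) : Set Ω :=
  {ω | (∀ t : ℝ, jumpTime (fun s => rescaled μ i s ω) (n + 1) = (t : EReal) →
          α₁ / √(n : ℝ) ≤ κ / (2 * μ t)) ∧
       (∀ t : ℝ, jumpTime (fun s => rescaled μ i s ω) n = (t : EReal) →
          m t ≤ α₂ * Real.exp (-α₃ * √(n : ℝ)))}

/-- The joint growth condition on the mass and the time change. -/
def GrowthCondition {Ω : Type*} [MeasurableSpace Ω] (P : Measure Ω) {N : ℕ} (κ : ℝ)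
    (m μ : ℝ → ℝ) (i : ℝ → Ω → Fin N) : Prop :=
  ∃ α₁ α₂ α₃ : ℝ, 0 < α₁ ∧ 0 < α₂ ∧ 0 < α₃ ∧
    Tendsto (fun k : ℕ => P (⋂ n ≥ k, growthEvent κ α₁ α₂ α₃ m μ i n)) atTop (𝓝 1)

/-- A mass function on `[0, ∞)`: positive, strictly decreasing, differentiable, vanishing at
infinity. -/
structure IsMass (m : ℝ → ℝ) : Prop where
  pos : ∀ t, 0 ≤ t → 0 < m t
  strictAnti : StrictAntiOn m (Ici 0)
  differentiable : DifferentiableOn ℝ m (Ici 0)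
  tendsto_zero : Tendsto m atTop (𝓝 0)

/-- The mass does not decrease too quickly: `|m'| ≤ lam * m`, with initial value at most `1`. -/
def IsSlowMass (lam : ℝ) (m : ℝ → ℝ) : Prop :=
  (∀ t, 0 < t → |deriv m t| ≤ lam * m t) ∧ m 0 ≤ 1

/-- The speed `μ` of the time change (the inverse of the learning rate): positive, non-decreasing
and continuously differentiable on `[0, ∞)`. -/
structure IsSpeed (μ : ℝ → ℝ) : Prop where
  pos : ∀ t, 0 ≤ t → 0 < μ t
  monotone : MonotoneOn μ (Ici 0)
  contDiff : ContDiffOn ℝ 1 μ (Ici 0)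

/-- `(q, p)` is the stochastic gradient-momentum process with mass `m`, unit friction and rescaled
index process `i^β`, i.e. almost surely
`dq = p dt`, `m(t) dp = -∇Φ_{i^β(t)}(q) dt - p dt`, `q(0) = q₀`, `p(0) = p₀`.
The right-hand side is only right-continuous in time, so the solution consists of continuous paths
which satisfy the differential equation with right derivatives at every time `t ≥ 0`. -/
structure IsDDSGMP {Ω : Type*} [MeasurableSpace Ω] (P : Measure Ω) {N K : ℕ}
    (Φ : Fin N → X K → ℝ) (m μ : ℝ → ℝ) (i : ℝ → Ω → Fin N) (q₀ p₀ : X K)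
    (q p : ℝ → Ω → X K) : Prop where
  measurable_q : ∀ t, 0 ≤ t → Measurable (q t)
  measurable_p : ∀ t, 0 ≤ t → Measurable (p t)
  cont_q : ∀ᵐ ω ∂P, ContinuousOn (fun t => q t ω) (Ici 0)
  cont_p : ∀ᵐ ω ∂P, ContinuousOn (fun t => p t ω) (Ici 0)
  init_q : ∀ᵐ ω ∂P, q 0 ω = q₀
  init_p : ∀ᵐ ω ∂P, p 0 ω = p₀
  deriv_q : ∀ᵐ ω ∂P, ∀ t, 0 ≤ t → HasDerivWithinAt (fun s => q s ω) (p t ω) (Ici t) t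
  deriv_p : ∀ᵐ ω ∂P, ∀ t, 0 ≤ t → HasDerivWithinAt (fun s => p s ω)
    ((m t)⁻¹ • (-(∇ (Φ (rescaled μ i t ω)) (q t ω)) - p t ω)) (Ici t) t

end SGMP

end

/-! Let `θ` be the zero of the averaged gradient, and replace `(q, p)` by `v = q - θ + m p` and `w =
m p`. The velocity `p` coming from `q` cancels against the friction, so `v' = (m'/m) w - ∇Φ_y(q)`,
where `y = i^β`, has no singular factor `1/m`: up to `w`, `v` follows a switched gradient flow. In
the derivative of the energy `‖v‖² + ‖w‖²`, strong convexity of the average contracts `v` at rate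
`κ`, while the friction `1/m` contracts `w` and absorbs all cross terms at a cost `O(m)`
(`IsDrift.energy_rate_le_fluctuation`). What remains is `fluctuation`, which sums to zero over the
states but is not small at a given time.

It is removed by averaging over windows of length `δ`. Freezing `v` at the left end costs `O(δ²)`,
and the frozen term integrates to a linear combination of excess occupation times
(`IsDrift.exists_window_bound`). Their second moments vanish as `t → ∞`, because the covariances of
the index process are at most `exp (-Nγ μ(t) |x - y|)` and `μ → ∞`
(`IsIndexProcess.tendsto_integral_occupation_sq`).

The energy has a deterministic bound uniform in the index path (`IsDrift.exists_energy_bound`), so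
all constants survive expectation: the mean energy satisfies `e(t + δ) ≤ exp (-κδ) e(t) + C δ² +
o(1)`. Hence its upper limit is `O(δ)` for every small `δ`, that is, zero
(`tendsto_zero_of_window_contraction`), and Markov's inequality gives convergence in probability. -/

namespace SGMP

/-! ### Existence and uniqueness of the minimiser. -/

section Minimiser

variable {K : ℕ}

/-- A function whose gradient is strongly monotone grows at least quadratically. -/
theorem quadratic_lower_bound {κ : ℝ} {f : X K → ℝ} {g : X K → X K}
    (hg : ∀ x, HasGradientAt f (g x) x)
    (hmono : ∀ x y, κ * ‖x - y‖ ^ 2 ≤ inner ℝ (x - y) (g x - g y)) (x : X K) :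
    f 0 + inner ℝ (g 0) x + κ / 2 * ‖x‖ ^ 2 ≤ f x := by
  -- Along the ray through `x`, strong monotonicity between `t • x` and `0` makes the derivative of
  -- this difference nonnegative.
  set φ : ℝ → ℝ := fun t => f (t • x) - t * inner ℝ (g 0) x - t ^ 2 * (κ / 2 * ‖x‖ ^ 2)
  have hφ : ∀ t, HasDerivAt φ
      (inner ℝ (g (t • x)) x - inner ℝ (g 0) x - κ * t * ‖x‖ ^ 2) t := by
    intro t
    have h1 : HasDerivAt (fun t : ℝ => f (t • x)) (inner ℝ (g (t • x)) x) t := by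
      have h := (hg (t • x)).hasFDerivAt.comp_hasDerivAt t ((hasDerivAt_id t).smul_const x)
      exact h.congr_deriv (by simp)
    have h2 : HasDerivAt (fun t : ℝ => t * inner ℝ (g 0) x) (inner ℝ (g 0) x) t := by
      simpa using (hasDerivAt_id t).mul_const (inner ℝ (g 0) x)
    have h3 : HasDerivAt (fun t : ℝ => t ^ 2 * (κ / 2 * ‖x‖ ^ 2)) (κ * t * ‖x‖ ^ 2) t := by
      refine ((hasDerivAt_pow 2 t).mul_const (κ / 2 * ‖x‖ ^ 2)).congr_deriv ?_
      push_cast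
      ring
    exact (h1.sub h2).sub h3
  have hmon : MonotoneOn φ (Icc 0 1) := by
    refine monotoneOn_of_deriv_nonneg (convex_Icc 0 1)
      (fun t _ => (hφ t).continuousAt.continuousWithinAt)
      (fun t _ => (hφ t).differentiableAt.differentiableWithinAt) fun t ht => ?_
    rw [interior_Icc] at ht
    rw [(hφ t).deriv]
    have h := hmono (t • x) 0
    rw [sub_zero, norm_smul, inner_smul_left, inner_sub_right, Real.norm_eq_abs, mul_pow, sq_abs,
      ← real_inner_comm x, ← real_inner_comm x] at h
    simp only [conj_trivial] at h
    have ht0 := ht.1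
    have : 0 ≤ t * (inner ℝ (g (t • x)) x - inner ℝ (g 0) x - κ * t * ‖x‖ ^ 2) := by
      linarith
    exact nonneg_of_mul_nonneg_right this ht0
  have h01 := hmon (left_mem_Icc.2 zero_le_one) (right_mem_Icc.2 zero_le_one) zero_le_one
  simp only [φ, zero_smul, one_smul] at h01
  linarith

/-- A function with strongly monotone gradient has a unique minimiser, where its gradient
vanishes. -/
theorem exists_unique_minimiser {κ : ℝ} (hκ : 0 < κ) {f : X K → ℝ} {g : X K → X K}
    (hg : ∀ x, HasGradientAt f (g x) x)
    (hmono : ∀ x y, κ * ‖x - y‖ ^ 2 ≤ inner ℝ (x - y) (g x - g y)) :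
    ∃ θ, g θ = 0 ∧ (∀ x, f θ ≤ f x) ∧ ∀ y, (∀ x, f y ≤ f x) → y = θ := by
  have hcont : Continuous f :=
    continuous_iff_continuousAt.2 fun x => (hg x).hasFDerivAt.continuousAt
  have hzero : ∀ y, (∀ x, f y ≤ f x) → g y = 0 := by
    intro y hy
    have h := IsLocalMin.hasFDerivAt_eq_zero
      (Filter.Eventually.of_forall hy : IsLocalMin f y) (hg y).hasFDerivAt
    simpa using h
  have hcoer : Tendsto f (cocompact (X K)) atTop := by
    have h1 : Tendsto (fun r : ℝ => f 0 + r * (κ / 2 * r - ‖g 0‖)) atTop atTop := by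
      refine tendsto_atTop_add_const_left _ _ (tendsto_id.atTop_mul_atTop₀ ?_)
      exact tendsto_atTop_add_const_right _ _ (tendsto_id.const_mul_atTop (by positivity))
    refine tendsto_atTop_mono (fun x => ?_) (h1.comp tendsto_norm_cocompact_atTop)
    have h2 := quadratic_lower_bound hg hmono x
    have h3 := neg_le_of_abs_le (abs_real_inner_le_norm (g 0) x)
    simp only [Function.comp]
    nlinarith
  obtain ⟨θ, hθ⟩ := hcont.exists_forall_le hcoer
  refine ⟨θ, hzero θ hθ, hθ, fun y hy => ?_⟩
  have h := hmono y θ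
  rw [hzero θ hθ, hzero y hy, sub_zero, inner_zero_right] at h
  have h1 : ‖y - θ‖ ^ 2 = 0 := le_antisymm (by nlinarith) (sq_nonneg _)
  exact sub_eq_zero.1 (norm_eq_zero.1 (pow_eq_zero_iff two_ne_zero |>.1 h1))

theorem hasGradientAt_avgPotential {N : ℕ} {Φ : Fin N → X K → ℝ} {L : ℝ≥0}
    (hΦ : ∀ j, IsC1LipschitzGradient L (Φ j)) (x : X K) :
    HasGradientAt (avgPotential Φ) ((1 / (N : ℝ)) • ∑ j, ∇ (Φ j) x) x := by
  have h : ∀ j, HasFDerivAt (Φ j) (InnerProductSpace.toDual ℝ (X K) (∇ (Φ j) x)) x := fun j =>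
    (((hΦ j).1.differentiable (by norm_num)).differentiableAt.hasGradientAt).hasFDerivAt
  have h1 := (HasFDerivAt.fun_sum (u := Finset.univ) fun j _ => h j).const_mul (1 / (N : ℝ))
  rw [hasGradientAt_iff_hasFDerivAt]
  refine h1.congr_fderiv ?_
  simp [map_sum]

/-- The averaged potential has a unique minimiser, a zero of the sum of the gradients. -/
theorem exists_unique_minimiser_avgPotential {N : ℕ} (hN : 1 ≤ N) {Φ : Fin N → X K → ℝ}
    {L : ℝ≥0} {κ : ℝ} (hκ : 0 < κ) (hΦ : ∀ j, IsC1LipschitzGradient L (Φ j))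
    (hconv : ∀ j, IsStronglyConvexWith κ (Φ j)) :
    ∃ θ, ∑ j, ∇ (Φ j) θ = 0 ∧ (∀ x, avgPotential Φ θ ≤ avgPotential Φ x) ∧
      ∀ y, (∀ x, avgPotential Φ y ≤ avgPotential Φ x) → y = θ := by
  have hN0 : (0 : ℝ) < N := by exact_mod_cast hN
  obtain ⟨θ, h1, h2⟩ := exists_unique_minimiser hκ (hasGradientAt_avgPotential hΦ) (κ := κ) (by
    intro x y
    rw [← smul_sub, ← Finset.sum_sub_distrib, inner_smul_right, inner_sum]
    have h := Finset.sum_le_sum fun j (_ : j ∈ Finset.univ) => hconv j x y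
    rw [Finset.sum_const, Finset.card_univ, Fintype.card_fin, nsmul_eq_mul] at h
    rw [one_div, ← div_eq_inv_mul, le_div_iff₀ hN0]
    linarith)
  refine ⟨θ, ?_, h2⟩
  rcases smul_eq_zero.1 h1 with h | h
  · exact absurd h (by positivity)
  · exact h

end Minimiser

/-! ### Explicit transition semigroup. -/

section TransitionMatrix

/-- All positive powers of `R` equal `R`, so the exponential series differs from `exp c • R` only in
its zeroth term, where `1` stands in place of `R`. -/
theorem exp_smul_of_isIdempotentElem {n : Type*} [Fintype n] [DecidableEq n]
    {R : Matrix n n ℝ} (hR : IsIdempotentElem R) (c : ℝ) :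
    NormedSpace.exp (c • R) = 1 + (Real.exp c - 1) • R := by
  have h2 : HasSum (fun k : ℕ => ((k.factorial : ℝ)⁻¹ • c ^ k) • R) (Real.exp c • R) := by
    have h := NormedSpace.exp_series_hasSum_exp' (𝕂 := ℝ) c
    rw [← Real.exp_eq_exp_ℝ] at h
    exact h.smul_const R
  have h3 : HasSum (fun k : ℕ => if k = 0 then (1 - R) else 0) (1 - R) := hasSum_ite_eq 0 _
  have h4 := h2.add h3
  have h5 : (fun k : ℕ => ((k.factorial : ℝ)⁻¹ • c ^ k) • R + if k = 0 then (1 - R) else 0) =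
      fun k : ℕ => (k.factorial : ℝ)⁻¹ • (c • R) ^ k := by
    funext k
    rcases Nat.eq_zero_or_pos k with rfl | hk
    · simp
    · rw [if_neg hk.ne', add_zero, smul_pow, hR.pow_eq hk.ne', smul_eq_mul, mul_smul]
  rw [h5] at h4
  rw [NormedSpace.exp_eq_tsum ℝ]
  simp only
  rw [h4.tsum_eq]
  module

/-- The generator is `-Nγ` times the projection `1 - J/N`, with `J` the all-ones matrix; the chain
therefore relaxes to uniformity at rate `Nγ`. -/
theorem exp_smul_rateMatrix_apply {N : ℕ} (hN : 1 ≤ N) (γ u : ℝ) (j k : Fin N) :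
    NormedSpace.exp (u • rateMatrix N γ) j k =
      (if j = k then Real.exp (-(N * γ * u)) else 0) +
        (1 - Real.exp (-(N * γ * u))) * (1 / (N : ℝ)) := by
  have hN0 : (N : ℝ) ≠ 0 := by positivity
  set R : Matrix (Fin N) (Fin N) ℝ := 1 - Matrix.of (fun _ _ => (1 / (N : ℝ)))
  have hR : IsIdempotentElem R := by
    refine IsIdempotentElem.one_sub ?_
    ext a b
    simp [Matrix.mul_apply]
    field_simp
  have hA : u • rateMatrix N γ = (-(N * γ * u)) • R := by
    ext a b
    simp only [rateMatrix, R, Matrix.smul_apply, Matrix.sub_apply, Matrix.of_apply, smul_eq_mul]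
    field_simp
    ring
  rw [hA, exp_smul_of_isIdempotentElem hR]
  simp only [R, Matrix.add_apply, Matrix.smul_apply, Matrix.sub_apply, Matrix.of_apply,
    smul_eq_mul, Matrix.one_apply]
  split_ifs <;> ring

end TransitionMatrix

/-! ### Stationarity and covariances of the index process. -/

section TwoTimeLaw

variable {Ω : Type*} [MeasurableSpace Ω] {P : Measure Ω} [IsProbabilityMeasure P] {N : ℕ} {γ : ℝ}
  {i : ℝ → Ω → Fin N}

/-- The field `law` fixes the first time at `0`, so the state at time `0` is summed out; the columns
of the transition matrix sum to `1`, which is stationarity of the uniform law. -/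
theorem IsIndexProcess.two_time_law (hN : 1 ≤ N) (hi : IsIndexProcess P γ i) {s r : ℝ}
    (hs : 0 ≤ s) (hsr : s ≤ r) (j k : Fin N) :
    P.real {ω | i s ω = j ∧ i r ω = k} =
      (1 / (N : ℝ)) * ((if j = k then Real.exp (-(N * γ * (r - s))) else 0) +
        (1 - Real.exp (-(N * γ * (r - s)))) * (1 / (N : ℝ))) := by
  have hN0 : (N : ℝ) ≠ 0 := by positivity
  have hmeas : ∀ l, MeasurableSet {ω | i 0 ω = l ∧ i s ω = j ∧ i r ω = k} := fun l =>
    (hi.measurable 0 le_rfl (measurableSet_singleton l)).inter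
      ((hi.measurable s hs (measurableSet_singleton j)).inter
        (hi.measurable r (hs.trans hsr) (measurableSet_singleton k)))
  have hunion : {ω | i s ω = j ∧ i r ω = k} =
      ⋃ l : Fin N, {ω | i 0 ω = l ∧ i s ω = j ∧ i r ω = k} := by
    ext ω; simp
  have hlaw : ∀ l, P.real {ω | i 0 ω = l ∧ i s ω = j ∧ i r ω = k} =
      (1 / (N : ℝ)) * (NormedSpace.exp (s • rateMatrix N γ) l j *
        NormedSpace.exp ((r - s) • rateMatrix N γ) j k) := by
    intro l
    have h := hi.law 2 ![0, s, r] rfl (by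
      intro a b hab
      fin_cases a <;> fin_cases b <;> (simp_all; try linarith)) ![l, j, k]
    have hset : {ω | ∀ a : Fin 3,
        i ((![0, s, r] : Fin 3 → ℝ) a) ω = (![l, j, k] : Fin 3 → Fin N) a} =
        {ω | i 0 ω = l ∧ i s ω = j ∧ i r ω = k} := by
      ext ω; simp [Fin.forall_fin_succ]
    rw [hset] at h
    rw [h, Fin.prod_univ_two]
    simp
  rw [hunion, measureReal_iUnion_fintype ?_ hmeas]
  · simp_rw [hlaw]
    rw [← Finset.mul_sum, ← Finset.sum_mul]
    have hone : ∑ l, NormedSpace.exp (s • rateMatrix N γ) l j = 1 := by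
      simp_rw [exp_smul_rateMatrix_apply hN]
      rw [Finset.sum_add_distrib]
      simp
      field_simp
      ring
    rw [hone, one_mul, exp_smul_rateMatrix_apply hN]
  · intro a b hab
    refine Set.disjoint_left.2 fun ω h1 h2 => hab ?_
    exact h1.1.symm.trans h2.1

/-- The indicator that `x = j`, centred with respect to the uniform distribution on `Fin N`. -/
noncomputable def centredIndicator (j x : Fin N) : ℝ := (if x = j then 1 else 0) - 1 / (N : ℝ)

theorem abs_centredIndicator_le (hN : 1 ≤ N) (j x : Fin N) : |centredIndicator j x| ≤ 1 := by
  have hN1 : (1 : ℝ) ≤ N := by exact_mod_cast hN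
  have h1 : 1 / (N : ℝ) ≤ 1 := by rw [div_le_one (by positivity)]; exact hN1
  have h0 : 0 ≤ 1 / (N : ℝ) := by positivity
  unfold centredIndicator
  rw [abs_le]
  split_ifs <;> constructor <;> linarith

/-- The covariance of the indicators decays exponentially. -/
theorem IsIndexProcess.covariance (hN : 1 ≤ N) (hi : IsIndexProcess P γ i) {s r : ℝ}
    (hs : 0 ≤ s) (hsr : s ≤ r) (j : Fin N) :
    ∫ ω, centredIndicator j (i s ω) * centredIndicator j (i r ω) ∂P =
      Real.exp (-(N * γ * (r - s))) * (1 / (N : ℝ) * (1 - 1 / (N : ℝ))) := by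
  have hms := hi.measurable s hs (measurableSet_singleton j)
  have hmr := hi.measurable r (hs.trans hsr) (measurableSet_singleton j)
  have hone : ∀ t, 0 ≤ t → P.real {ω | i t ω = j} = 1 / (N : ℝ) := by
    intro t ht
    have h := hi.two_time_law hN ht le_rfl j j
    simpa using h
  have hjoint := hi.two_time_law hN hs hsr j j
  rw [if_pos rfl] at hjoint
  set A := {ω | i s ω = j}
  set B := {ω | i r ω = j}
  have hfun : (fun ω => centredIndicator j (i s ω) * centredIndicator j (i r ω)) =
      fun ω => (A ∩ B).indicator (fun _ => (1 : ℝ)) ω - 1 / (N : ℝ) * A.indicator (fun _ => (1 : ℝ)) ω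
        - 1 / (N : ℝ) * B.indicator (fun _ => (1 : ℝ)) ω + 1 / (N : ℝ) * (1 / (N : ℝ)) := by
    funext ω
    by_cases h1 : i s ω = j <;> by_cases h2 : i r ω = j <;>
      simp [centredIndicator, A, B, Set.indicator, h1, h2] <;> ring
  have iAB : Integrable ((A ∩ B).indicator (fun _ => (1 : ℝ))) P :=
    (integrable_const 1).indicator (hms.inter hmr)
  have iA : Integrable (A.indicator (fun _ => (1 : ℝ))) P := (integrable_const 1).indicator hms
  have iB : Integrable (B.indicator (fun _ => (1 : ℝ))) P := (integrable_const 1).indicator hmr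
  have i1 : Integrable (fun ω => (A ∩ B).indicator (fun _ => (1 : ℝ)) ω -
      1 / (N : ℝ) * A.indicator (fun _ => (1 : ℝ)) ω) P := iAB.sub (iA.const_mul _)
  have i2 : Integrable (fun ω => (A ∩ B).indicator (fun _ => (1 : ℝ)) ω -
      1 / (N : ℝ) * A.indicator (fun _ => (1 : ℝ)) ω -
      1 / (N : ℝ) * B.indicator (fun _ => (1 : ℝ)) ω) P := i1.sub (iB.const_mul _)
  rw [hfun, integral_add i2 (integrable_const _), integral_sub i1 (iB.const_mul _),
    integral_sub iAB (iA.const_mul _), integral_const_mul, integral_const_mul,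
    integral_indicator_const (s := A ∩ B) _ (hms.inter hmr),
    integral_indicator_const (s := A) _ hms, integral_indicator_const (s := B) _ hmr,
    integral_const, hone s hs,
    hone r (hs.trans hsr), show (A ∩ B) = {ω | i s ω = j ∧ i r ω = j} from rfl, hjoint]
  simp
  ring

end TwoTimeLaw

/-! ### Growth and regularity of the time change. -/

section TimeChange

variable {μ : ℝ → ℝ}

theorem IsSpeed.intervalIntegrable (hμ : IsSpeed μ) {s r : ℝ} (hs : 0 ≤ s) (hr : 0 ≤ r) :
    IntervalIntegrable μ volume s r := by
  refine (hμ.contDiff.continuousOn.mono fun x hx => ?_).intervalIntegrable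
  exact (le_min hs hr).trans hx.1

theorem IsSpeed.timeChange_sub (hμ : IsSpeed μ) {s r : ℝ} (hs : 0 ≤ s) (hr : 0 ≤ r) :
    timeChange μ r - timeChange μ s = ∫ x in s..r, μ x :=
  intervalIntegral.integral_interval_sub_left (hμ.intervalIntegrable le_rfl hr)
    (hμ.intervalIntegrable le_rfl hs)

theorem IsSpeed.le_timeChange_sub (hμ : IsSpeed μ) {t s r : ℝ} (ht : 0 ≤ t) (hts : t ≤ s)
    (hsr : s ≤ r) : μ t * (r - s) ≤ timeChange μ r - timeChange μ s := by
  have hs := ht.trans hts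
  rw [hμ.timeChange_sub hs (hs.trans hsr)]
  have h := intervalIntegral.integral_mono_on hsr intervalIntegrable_const
    (hμ.intervalIntegrable hs (hs.trans hsr))
    fun x hx => hμ.monotone ht (hs.trans hx.1) (hts.trans hx.1)
  rw [intervalIntegral.integral_const, smul_eq_mul] at h
  linarith

theorem IsSpeed.timeChange_sub_le (hμ : IsSpeed μ) {t s r : ℝ} (hs : 0 ≤ s) (hsr : s ≤ r)
    (hrt : r ≤ t) : timeChange μ r - timeChange μ s ≤ μ t * (r - s) := by
  rw [hμ.timeChange_sub hs (hs.trans hsr)]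
  have h := intervalIntegral.integral_mono_on hsr (hμ.intervalIntegrable hs (hs.trans hsr))
    intervalIntegrable_const (g := fun _ => μ t)
    fun x hx => hμ.monotone (hs.trans hx.1) (hs.trans (hsr.trans hrt)) (hx.2.trans hrt)
  rw [intervalIntegral.integral_const, smul_eq_mul] at h
  linarith

theorem IsSpeed.timeChange_strictMonoOn (hμ : IsSpeed μ) : StrictMonoOn (timeChange μ) (Ici 0) := by
  intro s hs r _ hsr
  have h := hμ.le_timeChange_sub hs le_rfl hsr.le
  have := mul_pos (hμ.pos s hs) (sub_pos.2 hsr)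
  linarith

theorem IsSpeed.timeChange_nonneg (hμ : IsSpeed μ) {t : ℝ} (ht : 0 ≤ t) : 0 ≤ timeChange μ t := by
  have h := hμ.timeChange_strictMonoOn.monotoneOn self_mem_Ici ht ht
  simpa [timeChange] using h

/-- Strict monotonicity keeps the approach strictly from the right; this is what transfers
right-continuity from `i` to `i^β`. -/
theorem IsSpeed.tendsto_timeChange_right (hμ : IsSpeed μ) {t : ℝ} (ht : 0 ≤ t) :
    Tendsto (timeChange μ) (𝓝[>] t) (𝓝[>] (timeChange μ t)) := by
  refine tendsto_nhdsWithin_iff.2 ⟨?_, ?_⟩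
  · have hup : Tendsto (fun r => timeChange μ t + μ (t + 1) * (r - t)) (𝓝[>] t)
        (𝓝 (timeChange μ t)) := by
      have hc : Continuous fun r => timeChange μ t + μ (t + 1) * (r - t) := by fun_prop
      have h := hc.tendsto t
      rw [sub_self, mul_zero, add_zero] at h
      exact h.mono_left nhdsWithin_le_nhds
    refine tendsto_of_tendsto_of_tendsto_of_le_of_le' tendsto_const_nhds hup ?_ ?_
    · filter_upwards [self_mem_nhdsWithin] with r hr
      exact (hμ.timeChange_strictMonoOn ht (ht.trans (le_of_lt hr)) hr).le
    · filter_upwards [Ioc_mem_nhdsGT (show t < t + 1 by linarith)] with r hr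
      have := hμ.timeChange_sub_le ht hr.1.le hr.2
      linarith
  · filter_upwards [self_mem_nhdsWithin] with r hr
    exact hμ.timeChange_strictMonoOn ht (ht.trans (le_of_lt hr)) hr

end TimeChange

/-! ### Joint measurability of right-continuous processes. -/

section RightContinuous

/-- The smallest point of the grid `ℕ / (n + 1)` to the right of `s`. -/
noncomputable def rightGrid (n : ℕ) (s : ℝ) : ℝ := (⌊((n : ℝ) + 1) * s⌋₊ + 1) / ((n : ℝ) + 1)

theorem tendsto_rightGrid {s : ℝ} (hs : 0 ≤ s) :
    Tendsto (fun n => rightGrid n s) atTop (𝓝[>] s) := by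
  have hlt : ∀ n : ℕ, s < rightGrid n s := by
    intro n
    have hn : (0 : ℝ) < (n : ℝ) + 1 := by positivity
    rw [rightGrid, lt_div_iff₀ hn, mul_comm]
    exact Nat.lt_floor_add_one _
  refine tendsto_nhdsWithin_iff.2 ⟨?_, Eventually.of_forall hlt⟩
  have hup : Tendsto (fun n : ℕ => s + 1 / ((n : ℝ) + 1)) atTop (𝓝 s) := by
    simpa using tendsto_const_nhds.add (tendsto_one_div_add_atTop_nhds_zero_nat (𝕜 := ℝ))
  refine tendsto_of_tendsto_of_tendsto_of_le_of_le tendsto_const_nhds hup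
    (fun n => (hlt n).le) fun n => ?_
  have hn : (0 : ℝ) < (n : ℝ) + 1 := by positivity
  have h := Nat.floor_le (mul_nonneg hn.le hs)
  rw [rightGrid, div_le_iff₀ hn, add_mul s, div_mul_cancel₀ _ hn.ne']
  linarith

/-- A right-continuous process with discrete values is measurable in time and path jointly. -/
theorem aestronglyMeasurable_of_right_continuous {Z Ω S : Type*} [MeasurableSpace Z]
    [MeasurableSpace Ω] [MeasurableSpace S] [DiscreteMeasurableSpace S] {ρ : Measure Z}
    {Y : ℝ → Ω → S} (hY : ∀ t, 0 ≤ t → Measurable (Y t)) (f : S → ℝ) {T : Z → ℝ} {W : Z → Ω}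
    (hT : Measurable T) (hW : Measurable W)
    (hr : ∀ᵐ z ∂ρ, 0 ≤ T z ∧ ∀ᶠ s in 𝓝[>] (T z), Y s (W z) = Y (T z) (W z)) :
    AEStronglyMeasurable (fun z => f (Y (T z) (W z))) ρ := by
  refine AEMeasurable.aestronglyMeasurable ?_
  -- For fixed `n` only countably many grid times occur, which gives measurability; the grid points
  -- lie strictly to the right of `T z` and converge to it, so the approximations are eventually
  -- constant.
  refine aemeasurable_of_tendsto_metrizable_ae atTop
    (f := fun (n : ℕ) z => f (Y (rightGrid n (T z)) (W z))) (fun n => Measurable.aemeasurable ?_) ?_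
  · have h1 : Measurable fun a : ℕ × Ω => f (Y (((a.1 : ℝ) + 1) / ((n : ℝ) + 1)) a.2) :=
      measurable_from_prod_countable_right fun k =>
        (Measurable.of_discrete (f := f)).comp (hY (((k : ℝ) + 1) / ((n : ℝ) + 1)) (by positivity))
    exact h1.comp ((Nat.measurable_floor.comp (hT.const_mul _)).prodMk hW)
  · filter_upwards [hr] with z hz
    refine tendsto_const_nhds.congr' ?_
    filter_upwards [(tendsto_rightGrid hz.1).eventually hz.2] with n hn
    rw [hn]

end RightContinuous

/-! ### Mean-square averaging of the occupation times. -/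

section Occupation

variable {Ω : Type*} [MeasurableSpace Ω] {P : Measure Ω} {N : ℕ} {γ : ℝ}
  {i : ℝ → Ω → Fin N} {μ : ℝ → ℝ}

theorem IsIndexProcess.measurable_rescaled (hi : IsIndexProcess P γ i) (hμ : IsSpeed μ) {t : ℝ}
    (ht : 0 ≤ t) : Measurable (rescaled μ i t) :=
  hi.measurable _ (hμ.timeChange_nonneg ht)

theorem IsIndexProcess.rescaled_right_cont (hi : IsIndexProcess P γ i) (hμ : IsSpeed μ) :
    ∀ᵐ ω ∂P, ∀ t, 0 ≤ t → ∀ᶠ s in 𝓝[>] t, rescaled μ i s ω = rescaled μ i t ω := by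
  filter_upwards [hi.right_cont] with ω hω t ht
  exact (hμ.tendsto_timeChange_right ht).eventually (hω _ (hμ.timeChange_nonneg ht))

/-- The excess time that the path `y` spends in the state `j` between `t` and `r`. -/
noncomputable def occupation (y : ℝ → Fin N) (j : Fin N) (t r : ℝ) : ℝ :=
  ∫ s in t..r, centredIndicator j (y s)

theorem occupation_eq_setIntegral (y : ℝ → Fin N) (j : Fin N) (t : ℝ) {δ : ℝ} (hδ : 0 ≤ δ) :
    occupation y j t (t + δ) = ∫ x in Ioc 0 δ, centredIndicator j (y (t + x)) := by
  have h := intervalIntegral.integral_comp_add_left (a := 0) (b := δ)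
    (fun s => centredIndicator j (y s)) t
  rw [add_zero, intervalIntegral.integral_of_le hδ] at h
  rw [occupation, ← h]

theorem IsIndexProcess.aestronglyMeasurable_occupation (hi : IsIndexProcess P γ i)
    (hμ : IsSpeed μ) (j : Fin N) {t δ : ℝ} (ht : 0 ≤ t) (hδ : 0 ≤ δ) :
    AEStronglyMeasurable (fun ω => occupation (fun s => rescaled μ i s ω) j t (t + δ)) P := by
  simp_rw [occupation_eq_setIntegral _ j t hδ]
  have h : AEStronglyMeasurable
      (fun z : Ω × ℝ => centredIndicator j (rescaled μ i (t + z.2) z.1))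
      (P.prod (volume.restrict (Ioc 0 δ))) := by
    refine aestronglyMeasurable_of_right_continuous (fun t ht => hi.measurable_rescaled hμ ht) _
      (T := fun z : Ω × ℝ => t + z.2) (by fun_prop) measurable_fst ?_
    have h1 : ∀ᵐ z ∂(P.prod (volume.restrict (Ioc 0 δ))), z.2 ∈ Ioc 0 δ :=
      Measure.quasiMeasurePreserving_snd.ae (ae_restrict_mem measurableSet_Ioc)
    filter_upwards [h1, Measure.quasiMeasurePreserving_fst.ae (hi.rescaled_right_cont hμ)]
      with z hz hz'
    have h0 : 0 ≤ t + z.2 := by linarith [hz.1]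
    exact ⟨h0, hz' _ h0⟩
  exact h.integral_prod_right'

theorem abs_occupation_le (hN : 1 ≤ N) (y : ℝ → Fin N) (j : Fin N) {t r : ℝ} (htr : t ≤ r) :
    |occupation y j t r| ≤ r - t := by
  have h := intervalIntegral.norm_integral_le_of_norm_le_const (a := t) (b := r) (C := 1)
    (f := fun s => centredIndicator j (y s)) fun s _ => abs_centredIndicator_le hN j _
  rw [one_mul, abs_of_nonneg (sub_nonneg.2 htr)] at h
  exact h

variable [IsProbabilityMeasure P]

/-- After time `t` the clock `timeChange μ` runs at speed at least `μ t`, which multiplies the decay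
rate `Nγ`. -/
theorem abs_covariance_rescaled_le (hN : 1 ≤ N) (hγ : 0 < γ) (hi : IsIndexProcess P γ i)
    (hμ : IsSpeed μ) (j : Fin N) {t x y : ℝ} (ht : 0 ≤ t) (hx : 0 ≤ x) (hy : 0 ≤ y) :
    |∫ ω, centredIndicator j (rescaled μ i (t + x) ω) *
      centredIndicator j (rescaled μ i (t + y) ω) ∂P| ≤
      Real.exp (-(N * γ * (μ t * |x - y|))) := by
  have hN1 : (1 : ℝ) ≤ N := by exact_mod_cast hN
  have key : ∀ x y, 0 ≤ x → x ≤ y → |∫ ω, centredIndicator j (rescaled μ i (t + x) ω) *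
      centredIndicator j (rescaled μ i (t + y) ω) ∂P| ≤
      Real.exp (-(N * γ * (μ t * |x - y|))) := by
    intro x y hx hxy
    have hle := hμ.timeChange_strictMonoOn.monotoneOn (show (0 : ℝ) ≤ t + x by linarith)
      (show (0 : ℝ) ≤ t + y by linarith) (show t + x ≤ t + y by linarith)
    have h := hi.covariance hN (hμ.timeChange_nonneg (show 0 ≤ t + x by linarith)) hle j
    unfold rescaled
    rw [h, abs_mul, abs_of_pos (Real.exp_pos _)]
    have h1 : 1 / (N : ℝ) ≤ 1 := by rw [div_le_one (by positivity)]; exact hN1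
    have h0 : 0 ≤ 1 / (N : ℝ) := by positivity
    have hc : |1 / (N : ℝ) * (1 - 1 / (N : ℝ))| ≤ 1 := by
      rw [abs_le]; constructor <;> nlinarith
    refine (mul_le_of_le_one_right (Real.exp_pos _).le hc).trans (Real.exp_le_exp.2 ?_)
    rw [abs_sub_comm, abs_of_nonneg (sub_nonneg.2 hxy)]
    have h2 := hμ.le_timeChange_sub ht (show t ≤ t + x by linarith) (show t + x ≤ t + y by linarith)
    rw [show t + y - (t + x) = y - x by ring] at h2
    exact neg_le_neg (mul_le_mul_of_nonneg_left h2 (by positivity))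
  rcases le_total x y with hxy | hxy
  · exact key x y hx hxy
  · have h := key y x hy hxy
    rw [abs_sub_comm] at h
    simpa only [mul_comm] using h

/-- As the time change accelerates, the index process spends the same time in every state. -/
theorem IsIndexProcess.tendsto_integral_occupation_sq (hN : 1 ≤ N) (hγ : 0 < γ)
    (hi : IsIndexProcess P γ i) (hμ : IsSpeed μ) (hμ_top : Tendsto μ atTop atTop) (j : Fin N)
    {δ : ℝ} (hδ : 0 ≤ δ) :
    Tendsto (fun t => ∫ ω, occupation (fun s => rescaled μ i s ω) j t (t + δ) ^ 2 ∂P)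
      atTop (𝓝 0) := by
  set ν : Measure ℝ := volume.restrict (Ioc 0 δ)
  set F : ℝ → Ω → ℝ × ℝ → ℝ := fun t ω z => centredIndicator j (rescaled μ i (t + z.1) ω) *
    centredIndicator j (rescaled μ i (t + z.2) ω)
  have hν : ∀ᵐ z ∂(ν.prod ν), z.1 ∈ Ioc 0 δ ∧ z.2 ∈ Ioc 0 δ :=
    (Measure.quasiMeasurePreserving_fst.ae (ae_restrict_mem measurableSet_Ioc)).and
      (Measure.quasiMeasurePreserving_snd.ae (ae_restrict_mem measurableSet_Ioc))
  have hF1 : ∀ t ω z, ‖F t ω z‖ ≤ 1 := by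
    intro t ω z
    rw [Real.norm_eq_abs, abs_mul]
    exact mul_le_one₀ (abs_centredIndicator_le hN _ _) (abs_nonneg _)
      (abs_centredIndicator_le hN _ _)
  have hInt : ∀ t, 0 ≤ t → Integrable (Function.uncurry (F t)) (P.prod (ν.prod ν)) := by
    intro t ht
    refine Integrable.of_bound (C := 1) ?_ (Eventually.of_forall fun z => hF1 t z.1 z.2)
    have haux : ∀ T : Ω × ℝ × ℝ → ℝ, Measurable T → (∀ᵐ z ∂(P.prod (ν.prod ν)), 0 ≤ T z) →
        AEStronglyMeasurable (fun z : Ω × ℝ × ℝ => centredIndicator j (rescaled μ i (T z) z.1))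
          (P.prod (ν.prod ν)) := by
      intro T hT hT0
      refine aestronglyMeasurable_of_right_continuous (fun t ht => hi.measurable_rescaled hμ ht) _
        hT measurable_fst ?_
      filter_upwards [hT0, Measure.quasiMeasurePreserving_fst.ae (hi.rescaled_right_cont hμ)]
        with z hz hz'
      exact ⟨hz, hz' _ hz⟩
    have hz := (Measure.quasiMeasurePreserving_snd (μ := P) (ν := ν.prod ν)).ae hν
    refine (haux (fun z => t + z.2.1) (by fun_prop) ?_).mul
      (haux (fun z => t + z.2.2) (by fun_prop) ?_)
    · filter_upwards [hz] with z hz; linarith [hz.1.1]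
    · filter_upwards [hz] with z hz; linarith [hz.2.1]
  have hsq : ∀ t, 0 ≤ t → ∫ ω, occupation (fun s => rescaled μ i s ω) j t (t + δ) ^ 2 ∂P =
      ∫ z, ∫ ω, F t ω z ∂P ∂(ν.prod ν) := by
    intro t ht
    -- The squared occupation time is a double integral over the window; Fubini turns its mean into
    -- a double integral of covariances.
    rw [← integral_integral_swap (hInt t ht)]
    refine integral_congr_ae (Eventually.of_forall fun ω => ?_)
    simp only [F]
    rw [occupation_eq_setIntegral _ j t hδ, sq]
    exact (integral_prod_mul (μ := ν) (ν := ν)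
      (fun x => centredIndicator j (rescaled μ i (t + x) ω))
      (fun x => centredIndicator j (rescaled μ i (t + x) ω))).symm
  -- The covariance bound is trivial on the diagonal, which is a null set; off it the bound tends to
  -- `0` since `μ → ∞`.
  have hdiag : ∀ᵐ z ∂(ν.prod ν), z.1 ≠ z.2 := by
    have h : (ν.prod ν) (diagonal ℝ) = 0 := by
      rw [Measure.measure_prod_null measurableSet_diagonal]
      refine Eventually.of_forall fun x => ?_
      have : Prod.mk x ⁻¹' diagonal ℝ = {x} := by ext y; simp [eq_comm]
      simp only [this]
      simp
    exact measure_eq_zero_iff_ae_notMem.1 h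
  have hlim : Tendsto (fun t => ∫ z, ∫ ω, F t ω z ∂P ∂(ν.prod ν)) atTop
      (𝓝 (∫ _ : ℝ × ℝ, (0 : ℝ) ∂(ν.prod ν))) := by
    refine tendsto_integral_filter_of_dominated_convergence (fun _ => 1) ?_ ?_
      (integrable_const 1) ?_
    · filter_upwards [eventually_ge_atTop 0] with t ht
      exact (hInt t ht).integral_prod_right.aestronglyMeasurable
    · refine Eventually.of_forall fun t => Eventually.of_forall fun z => ?_
      refine (norm_integral_le_of_norm_le_const (Eventually.of_forall fun ω => hF1 t ω z)).trans ?_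
      simp
    · filter_upwards [hν, hdiag] with z hz hne
      have hN1 : (1 : ℝ) ≤ N := by exact_mod_cast hN
      have hpos : 0 < N * γ * |z.1 - z.2| :=
        mul_pos (by positivity) (abs_pos.2 (sub_ne_zero.2 hne))
      have h0 : Tendsto (fun t => Real.exp (-(N * γ * (μ t * |z.1 - z.2|)))) atTop (𝓝 0) := by
        refine Real.tendsto_exp_neg_atTop_nhds_zero.comp ?_
        refine (hμ_top.atTop_mul_const hpos).congr fun t => ?_
        ring
      refine squeeze_zero_norm' ?_ h0
      filter_upwards [eventually_ge_atTop 0] with t ht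
      exact abs_covariance_rescaled_le hN hγ hi hμ j ht hz.1.1.le hz.2.1.le
  rw [integral_zero] at hlim
  refine hlim.congr' ?_
  filter_upwards [eventually_ge_atTop 0] with t ht
  exact (hsq t ht).symm

end Occupation

/-! ### Occupation times along a single path. -/

section OccupationPath

variable {N : ℕ} {y : ℝ → Fin N}

theorem aestronglyMeasurable_path (hy : ∀ t, 0 ≤ t → ∀ᶠ s in 𝓝[>] t, y s = y t) (f : Fin N → ℝ) :
    AEStronglyMeasurable (fun s => f (y s)) (volume.restrict (Ici 0)) := by
  refine aestronglyMeasurable_of_right_continuous (Y := fun t (_ : Unit) => y t)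
    (fun _ _ => measurable_const) f (T := fun s => s) (W := fun _ => ()) measurable_id
    measurable_const ?_
  filter_upwards [ae_restrict_mem measurableSet_Ici] with s hs
  exact ⟨hs, hy s hs⟩

theorem intervalIntegrable_centredIndicator (hN : 1 ≤ N)
    (hy : ∀ t, 0 ≤ t → ∀ᶠ s in 𝓝[>] t, y s = y t) (j : Fin N) {a b : ℝ} (ha : 0 ≤ a)
    (hab : a ≤ b) : IntervalIntegrable (fun s => centredIndicator j (y s)) volume a b := by
  rw [intervalIntegrable_iff_integrableOn_Ioc_of_le hab]
  refine Integrable.of_bound (C := 1) ?_ (Eventually.of_forall fun s =>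
    abs_centredIndicator_le hN j (y s))
  exact (aestronglyMeasurable_path hy (centredIndicator j)).mono_set fun s hs =>
    (ha.trans hs.1.le : (0 : ℝ) ≤ s)

theorem continuousOn_occupation (hN : 1 ≤ N) (hy : ∀ t, 0 ≤ t → ∀ᶠ s in 𝓝[>] t, y s = y t)
    (j : Fin N) {a b : ℝ} (ha : 0 ≤ a) (hab : a ≤ b) :
    ContinuousOn (fun s => occupation y j a s) (Icc a b) := by
  have h := intervalIntegral.continuousOn_primitive_interval'
    (intervalIntegrable_centredIndicator hN hy j ha hab) left_mem_uIcc
  rwa [uIcc_of_le hab] at h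

/-- Right-continuity gives a right derivative at every time, jump times included, as the comparison
theorem in the window estimate requires. -/
theorem hasDerivWithinAt_occupation (hN : 1 ≤ N) (hy : ∀ t, 0 ≤ t → ∀ᶠ s in 𝓝[>] t, y s = y t)
    (j : Fin N) {a s : ℝ} (ha : 0 ≤ a) (has : a ≤ s) :
    HasDerivWithinAt (fun s => occupation y j a s) (centredIndicator j (y s)) (Ici s) s := by
  refine intervalIntegral.integral_hasDerivWithinAt_right (t := Ioi s)
    (intervalIntegrable_centredIndicator hN hy j ha has) ?_ ?_
  · refine ⟨Ioi s, self_mem_nhdsWithin, ?_⟩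
    exact (aestronglyMeasurable_path hy (centredIndicator j)).mono_set fun r hr =>
      (ha.trans (has.trans (le_of_lt hr)) : (0 : ℝ) ≤ r)
  · refine tendsto_const_nhds.congr' ?_
    filter_upwards [hy s (ha.trans has)] with r hr
    rw [hr]

end OccupationPath

/-! ### Energy of the momentum dynamics. -/

section Dynamics

variable {N K : ℕ}

/-- A family of Lipschitz, strongly monotone vector fields whose sum vanishes at `θ`. -/
structure IsDrift (b : Fin N → X K → X K) (L κ : ℝ) (θ : X K) : Prop where
  nonneg : 0 ≤ L
  lipschitz : ∀ j x z, ‖b j x - b j z‖ ≤ L * ‖x - z‖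
  monotone : ∀ j x z, κ * ‖x - z‖ ^ 2 ≤ inner ℝ (x - z) (b j x - b j z)
  sum_eq_zero : ∑ j, b j θ = 0

/-- `(q, p)` solves `dq = p dt`, `m(t) dp = -b_{y(t)}(q) dt - p dt` with right derivatives. -/
structure IsMomentumPath (b : Fin N → X K → X K) (m : ℝ → ℝ) (y : ℝ → Fin N) (q₀ p₀ : X K)
    (q p : ℝ → X K) : Prop where
  cont_q : ContinuousOn q (Ici 0)
  cont_p : ContinuousOn p (Ici 0)
  init_q : q 0 = q₀
  init_p : p 0 = p₀
  deriv_q : ∀ t, 0 ≤ t → HasDerivWithinAt q (p t) (Ici t) t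
  deriv_p : ∀ t, 0 ≤ t → HasDerivWithinAt p ((m t)⁻¹ • (-(b (y t) (q t)) - p t)) (Ici t) t

/-- The position relative to `θ`, corrected by the momentum. -/
noncomputable def position (θ : X K) (m : ℝ → ℝ) (q p : ℝ → X K) (t : ℝ) : X K :=
  q t - θ + m t • p t

/-- The energy of the pair of corrected position and momentum. -/
noncomputable def energy (θ : X K) (m : ℝ → ℝ) (q p : ℝ → X K) (t : ℝ) : ℝ :=
  ‖position θ m q p t‖ ^ 2 + ‖m t • p t‖ ^ 2

theorem energy_nonneg (θ : X K) (m : ℝ → ℝ) (q p : ℝ → X K) (t : ℝ) : 0 ≤ energy θ m q p t := by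
  unfold energy; positivity

theorem norm_sub_sq_le_energy (θ : X K) (m : ℝ → ℝ) (q p : ℝ → X K) (t : ℝ) :
    ‖q t - θ‖ ^ 2 ≤ 2 * energy θ m q p t := by
  have h : q t - θ = position θ m q p t - m t • p t := by unfold position; abel
  have h1 := norm_sub_le (position θ m q p t) (m t • p t)
  rw [← h] at h1
  unfold energy
  nlinarith [norm_nonneg (q t - θ), norm_nonneg (position θ m q p t), norm_nonneg (m t • p t),
    sq_nonneg (‖position θ m q p t‖ - ‖m t • p t‖)]

/-! ### Pointwise estimates for the drifts and their fluctuations. -/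

section Drift

variable {b : Fin N → X K → X K} {L κ : ℝ} {θ : X K}

/-- A bound for the drifts at `θ`. -/
noncomputable def driftBound (b : Fin N → X K → X K) (θ : X K) : ℝ := ∑ j, ‖b j θ‖

theorem driftBound_nonneg (b : Fin N → X K → X K) (θ : X K) : 0 ≤ driftBound b θ :=
  Finset.sum_nonneg fun _ _ => norm_nonneg _

theorem norm_drift_le (b : Fin N → X K → X K) (θ : X K) (j : Fin N) :
    ‖b j θ‖ ≤ driftBound b θ :=
  Finset.single_le_sum (f := fun j => ‖b j θ‖) (fun _ _ => norm_nonneg _) (Finset.mem_univ j)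

theorem IsDrift.norm_le (hb : IsDrift b L κ θ) (j : Fin N) (x : X K) :
    ‖b j x‖ ≤ driftBound b θ + L * ‖x - θ‖ := by
  have h1 := hb.lipschitz j x θ
  have h2 := norm_drift_le b θ j
  have h3 : ‖b j x‖ ≤ ‖b j x - b j θ‖ + ‖b j θ‖ := by
    simpa using norm_add_le (b j x - b j θ) (b j θ)
  linarith

/-- The basic estimate of the rate of change of the energy. -/
theorem IsDrift.energy_rate_le (hb : IsDrift b L κ θ) (j : Fin N) {v w x : X K} {a c : ℝ}
    (ha : |a| ≤ 1) (hx : x = θ + v - w) :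
    2 * inner ℝ v (a • w - b j x) + 2 * inner ℝ w (a • w - b j x - c • w) ≤
      -2 * inner ℝ v (b j (θ + v)) + (4 * L + 2) * (‖v‖ * ‖w‖) + 2 * driftBound b θ * ‖w‖ +
        (2 * L + 2) * ‖w‖ ^ 2 - 2 * c * ‖w‖ ^ 2 := by
  have hL := hb.nonneg
  have h1 : ‖b j (θ + v) - b j x‖ ≤ L * ‖w‖ := by
    have h := hb.lipschitz j (θ + v) x
    rwa [hx, show θ + v - (θ + v - w) = w by abel, ← hx] at h
  have h2 : ‖b j x‖ ≤ driftBound b θ + L * (‖v‖ + ‖w‖) := by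
    refine (hb.norm_le j x).trans ?_
    have h : ‖x - θ‖ ≤ ‖v‖ + ‖w‖ := by
      rw [hx, show θ + v - w - θ = v - w by abel]
      exact norm_sub_le v w
    gcongr
  have h3 : inner ℝ v (b j (θ + v) - b j x) ≤ ‖v‖ * (L * ‖w‖) :=
    (real_inner_le_norm _ _).trans (by gcongr)
  have h4 : a * inner ℝ v w ≤ ‖v‖ * ‖w‖ := by
    refine (le_abs_self _).trans ?_
    rw [abs_mul]
    exact (mul_le_of_le_one_left (abs_nonneg _) ha).trans (abs_real_inner_le_norm _ _)
  have h5 : -inner ℝ w (b j x) ≤ ‖w‖ * (driftBound b θ + L * (‖v‖ + ‖w‖)) := by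
    refine (neg_le_of_abs_le (abs_real_inner_le_norm _ _) |> neg_le.1).trans ?_
    gcongr
  have h6 : a * ‖w‖ ^ 2 ≤ ‖w‖ ^ 2 :=
    mul_le_of_le_one_left (sq_nonneg _) ((le_abs_self a).trans ha)
  rw [inner_sub_right] at h3
  simp only [inner_sub_right, inner_smul_right, real_inner_self_eq_norm_sq]
  nlinarith

/-- The averaged vector field. -/
noncomputable def avgDrift (b : Fin N → X K → X K) (x : X K) : X K :=
  (1 / (N : ℝ)) • ∑ j, b j x

theorem IsDrift.avgDrift_lipschitz (hN : 1 ≤ N) (hb : IsDrift b L κ θ) (x z : X K) :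
    ‖avgDrift b x - avgDrift b z‖ ≤ L * ‖x - z‖ := by
  have hN0 : (0 : ℝ) < N := by exact_mod_cast hN
  unfold avgDrift
  rw [← smul_sub, ← Finset.sum_sub_distrib, norm_smul, Real.norm_of_nonneg (by positivity)]
  have h := (norm_sum_le _ _).trans
    (Finset.sum_le_sum fun j (_ : j ∈ Finset.univ) => hb.lipschitz j x z)
  rw [Finset.sum_const, Finset.card_univ, Fintype.card_fin, nsmul_eq_mul] at h
  rw [one_div, ← div_eq_inv_mul, div_le_iff₀ hN0]
  linarith

theorem IsDrift.avgDrift_eq_zero (hb : IsDrift b L κ θ) : avgDrift b θ = 0 := by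
  rw [avgDrift, hb.sum_eq_zero, smul_zero]

theorem IsDrift.avgDrift_monotone (hN : 1 ≤ N) (hb : IsDrift b L κ θ) (v : X K) :
    κ * ‖v‖ ^ 2 ≤ inner ℝ v (avgDrift b (θ + v)) := by
  have hN0 : (0 : ℝ) < N := by exact_mod_cast hN
  have h := Finset.sum_le_sum fun j (_ : j ∈ Finset.univ) => hb.monotone j (θ + v) θ
  rw [← inner_sum, Finset.sum_sub_distrib, hb.sum_eq_zero, sub_zero, add_sub_cancel_left,
    Finset.sum_const, Finset.card_univ, Fintype.card_fin, nsmul_eq_mul] at h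
  rw [avgDrift, inner_smul_right, one_div, ← div_eq_inv_mul, le_div_iff₀ hN0]
  linarith

/-- Twice the work of the fluctuation of the drift `b j` around the averaged vector field. -/
noncomputable def fluctuation (b : Fin N → X K → X K) (θ : X K) (j : Fin N) (v : X K) : ℝ :=
  2 * inner ℝ v (avgDrift b (θ + v) - b j (θ + v))

theorem sum_fluctuation (hN : 1 ≤ N) (b : Fin N → X K → X K) (θ v : X K) :
    ∑ j, fluctuation b θ j v = 0 := by
  have hN0 : (N : ℝ) ≠ 0 := by positivity
  unfold fluctuation
  rw [← Finset.mul_sum, ← inner_sum, Finset.sum_sub_distrib, Finset.sum_const, Finset.card_univ,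
    Fintype.card_fin, avgDrift, ← Nat.cast_smul_eq_nsmul ℝ, smul_smul, mul_one_div_cancel hN0]
  simp

/-- Centring the indicators changes nothing because the fluctuations sum to zero. With `v` frozen,
the time integral of the left side thus becomes a linear combination of occupation times. -/
theorem fluctuation_eq_sum (hN : 1 ≤ N) (b : Fin N → X K → X K) (θ v : X K) (k : Fin N) :
    fluctuation b θ k v = ∑ j, fluctuation b θ j v * centredIndicator j k := by
  unfold centredIndicator
  simp_rw [mul_sub]
  rw [Finset.sum_sub_distrib, ← Finset.sum_mul, sum_fluctuation hN]
  simp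

theorem IsDrift.norm_avgDrift_sub_le (hN : 1 ≤ N) (hb : IsDrift b L κ θ) (j : Fin N) {v : X K}
    {B : ℝ} (hv : ‖v‖ ≤ B) :
    ‖avgDrift b (θ + v) - b j (θ + v)‖ ≤ driftBound b θ + 2 * L * B := by
  have hL := hb.nonneg
  have h1 := hb.avgDrift_lipschitz hN (θ + v) θ
  rw [hb.avgDrift_eq_zero, sub_zero, add_sub_cancel_left] at h1
  have h2 := hb.norm_le j (θ + v)
  rw [add_sub_cancel_left] at h2
  have h3 := norm_sub_le (avgDrift b (θ + v)) (b j (θ + v))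
  nlinarith

theorem IsDrift.abs_fluctuation_le (hN : 1 ≤ N) (hb : IsDrift b L κ θ) (j : Fin N) {v : X K}
    {B : ℝ} (hv : ‖v‖ ≤ B) :
    |fluctuation b θ j v| ≤ 2 * B * (driftBound b θ + 2 * L * B) := by
  have h := abs_real_inner_le_norm v (avgDrift b (θ + v) - b j (θ + v))
  have h1 := hb.norm_avgDrift_sub_le hN j hv
  have hB : 0 ≤ B := (norm_nonneg v).trans hv
  have h2 := mul_le_mul hv h1 (norm_nonneg _) hB
  unfold fluctuation
  rw [abs_mul, abs_two]
  linarith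

/-- This controls the error of freezing `v` at the start of a window; the Lipschitz constant depends
on the radius `B` because both factors of the inner product vary with `v`. -/
theorem IsDrift.abs_fluctuation_sub_le (hN : 1 ≤ N) (hb : IsDrift b L κ θ) (j : Fin N)
    {v u : X K} {B : ℝ} (hv : ‖v‖ ≤ B) (hu : ‖u‖ ≤ B) :
    |fluctuation b θ j v - fluctuation b θ j u| ≤
      (2 * driftBound b θ + 8 * L * B) * ‖v - u‖ := by
  have hL := hb.nonneg
  have hB : 0 ≤ B := (norm_nonneg v).trans hv
  set f : X K → X K := fun v => avgDrift b (θ + v) - b j (θ + v)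
  have hf : ‖f v - f u‖ ≤ 2 * L * ‖v - u‖ := by
    have h1 := hb.avgDrift_lipschitz hN (θ + v) (θ + u)
    have h2 := hb.lipschitz j (θ + v) (θ + u)
    rw [add_sub_add_left_eq_sub] at h1 h2
    have h3 := norm_sub_le (avgDrift b (θ + v) - avgDrift b (θ + u)) (b j (θ + v) - b j (θ + u))
    have h4 : f v - f u =
        avgDrift b (θ + v) - avgDrift b (θ + u) - (b j (θ + v) - b j (θ + u)) := by
      simp only [f]; abel
    rw [h4]
    linarith
  have hfv : ‖f v‖ ≤ driftBound b θ + 2 * L * B := hb.norm_avgDrift_sub_le hN j hv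
  have heq : fluctuation b θ j v - fluctuation b θ j u =
      2 * (inner ℝ (v - u) (f v) + inner ℝ u (f v - f u)) := by
    simp only [fluctuation, f, inner_sub_left, inner_sub_right]; ring
  have h1 : |inner ℝ (v - u) (f v)| ≤ ‖v - u‖ * (driftBound b θ + 2 * L * B) :=
    (abs_real_inner_le_norm _ _).trans (by gcongr)
  have h2 : |inner ℝ u (f v - f u)| ≤ B * (2 * L * ‖v - u‖) :=
    (abs_real_inner_le_norm _ _).trans (mul_le_mul hu hf (norm_nonneg _) hB)
  rw [heq, abs_mul, abs_two]
  have h3 := abs_add_le (inner ℝ (v - u) (f v)) (inner ℝ u (f v - f u))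
  linarith

end Drift

/-! ### Energy estimates along a single path. -/

section Path

variable {b : Fin N → X K → X K} {L κ : ℝ} {θ q₀ p₀ : X K} {m : ℝ → ℝ} {y : ℝ → Fin N}
  {q p : ℝ → X K}

theorem IsMass.hasDerivAt (hm : IsMass m) {t : ℝ} (ht : 0 < t) : HasDerivAt m (deriv m t) t :=
  ((hm.differentiable t ht.le).differentiableAt (Ici_mem_nhds ht)).hasDerivAt

/-- The logarithmic derivative of the mass. -/
noncomputable def massRate (m : ℝ → ℝ) (t : ℝ) : ℝ := deriv m t * (m t)⁻¹

theorem abs_massRate_le (hm : IsMass m) (hslow : IsSlowMass (min (κ / 4) (1 / 4)) m) {t : ℝ}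
    (ht : 0 < t) : |massRate m t| ≤ 1 := by
  have hpos := hm.pos t ht.le
  rw [massRate, abs_mul, abs_inv, abs_of_pos hpos, ← div_eq_mul_inv, div_le_one hpos]
  refine (hslow.1 t ht).trans ?_
  have := min_le_right (κ / 4) (1 / 4 : ℝ)
  nlinarith

theorem IsMomentumPath.hasDerivWithinAt_momentum (hm : IsMass m)
    (h : IsMomentumPath b m y q₀ p₀ q p) {t : ℝ} (ht : 0 < t) :
    HasDerivWithinAt (fun s => m s • p s)
      (massRate m t • (m t • p t) - b (y t) (q t) - (m t)⁻¹ • (m t • p t)) (Ici t) t := by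
  have hpos := (hm.pos t ht.le).ne'
  refine ((hm.hasDerivAt ht).hasDerivWithinAt.smul (h.deriv_p t ht.le)).congr_deriv ?_
  rw [massRate, smul_smul, smul_smul, smul_smul, mul_assoc, inv_mul_cancel₀ hpos,
    mul_inv_cancel₀ hpos, mul_one, one_smul, one_smul]
  abel

/-- The velocity `p` from `q` cancels the friction term of `m • p`, leaving no factor `1/m`. -/
theorem IsMomentumPath.hasDerivWithinAt_position (hm : IsMass m)
    (h : IsMomentumPath b m y q₀ p₀ q p) {t : ℝ} (ht : 0 < t) :
    HasDerivWithinAt (position θ m q p)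
      (massRate m t • (m t • p t) - b (y t) (q t)) (Ici t) t := by
  have hpos := (hm.pos t ht.le).ne'
  refine (((h.deriv_q t ht.le).sub_const θ).add
    (h.hasDerivWithinAt_momentum hm ht)).congr_deriv ?_
  rw [smul_smul (m t)⁻¹, inv_mul_cancel₀ hpos, one_smul]
  abel

theorem IsMomentumPath.hasDerivWithinAt_energy (hm : IsMass m)
    (h : IsMomentumPath b m y q₀ p₀ q p) {t : ℝ} (ht : 0 < t) :
    HasDerivWithinAt (energy θ m q p)
      (2 * inner ℝ (position θ m q p t) (massRate m t • (m t • p t) - b (y t) (q t)) +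
        2 * inner ℝ (m t • p t)
          (massRate m t • (m t • p t) - b (y t) (q t) - (m t)⁻¹ • (m t • p t))) (Ici t) t :=
  (h.hasDerivWithinAt_position hm ht).norm_sq.add (h.hasDerivWithinAt_momentum hm ht).norm_sq

theorem IsMomentumPath.continuousOn_momentum (hm : IsMass m)
    (h : IsMomentumPath b m y q₀ p₀ q p) : ContinuousOn (fun s => m s • p s) (Ici 0) :=
  hm.differentiable.continuousOn.smul h.cont_p

theorem IsMomentumPath.continuousOn_position (hm : IsMass m)
    (h : IsMomentumPath b m y q₀ p₀ q p) : ContinuousOn (position θ m q p) (Ici 0) :=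
  (h.cont_q.sub continuousOn_const).add (h.continuousOn_momentum hm)

theorem IsMomentumPath.continuousOn_energy (hm : IsMass m)
    (h : IsMomentumPath b m y q₀ p₀ q p) : ContinuousOn (energy θ m q p) (Ici 0) :=
  ((h.continuousOn_position hm).norm.pow 2).add ((h.continuousOn_momentum hm).norm.pow 2)

/-- Grönwall's inequality for right derivatives. -/
theorem le_gronwallBound_of_hasDerivWithinAt {f f' : ℝ → ℝ} {δ A ε a c : ℝ}
    (hf : ContinuousOn f (Icc a c)) (hf' : ∀ x ∈ Ico a c, HasDerivWithinAt f (f' x) (Ici x) x)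
    (ha : f a ≤ δ) (bound : ∀ x ∈ Ico a c, f' x ≤ A * f x + ε) :
    ∀ x ∈ Icc a c, f x ≤ gronwallBound δ A ε (x - a) :=
  le_gronwallBound_of_liminf_deriv_right_le hf
    (fun x hx _ hr => (hf' x hx).liminf_right_slope_le hr) ha bound

/-- An a priori bound on bounded time intervals, uniform in the index path. -/
theorem IsDrift.exists_energy_le (hb : IsDrift b L κ θ) (hm : IsMass m) (hm1 : m 0 ≤ 1)
    (q₀ p₀ : X K) {T : ℝ} (hT : 0 ≤ T) :
    ∃ D, ∀ (y : ℝ → Fin N) (q p : ℝ → X K), IsMomentumPath b m y q₀ p₀ q p →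
      energy θ m q p T ≤ D := by
  have hL := hb.nonneg
  set M := (m T)⁻¹
  have hM0 : 0 < M := inv_pos.2 (hm.pos T hT)
  set G := driftBound b θ
  have hG : 0 ≤ G := driftBound_nonneg b θ
  refine ⟨3 * gronwallBound (‖q₀ - θ‖ ^ 2 + ‖p₀‖ ^ 2) (1 + M + M * L) (M * G ^ 2) T, ?_⟩
  intro y q p h
  -- The unweighted quantity `‖q - θ‖² + ‖p‖²` is used because its derivative does not involve `m'`,
  -- which is controlled only for `t > 0`. It dominates `energy` up to the factor `3`, since `m T ≤
  -- 1`.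
  have key := le_gronwallBound_of_hasDerivWithinAt (f := fun t => ‖q t - θ‖ ^ 2 + ‖p t‖ ^ 2)
    (f' := fun t => 2 * inner ℝ (q t - θ) (p t) +
      2 * inner ℝ (p t) ((m t)⁻¹ • (-(b (y t) (q t)) - p t)))
    (δ := ‖q₀ - θ‖ ^ 2 + ‖p₀‖ ^ 2) (A := 1 + M + M * L) (ε := M * G ^ 2) (a := 0) (c := T)
    ?_ ?_ ?_ ?_ T (right_mem_Icc.2 hT)
  · rw [sub_zero] at key
    refine le_trans ?_ (mul_le_mul_of_nonneg_left key (by norm_num))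
    have hmT : m T ≤ 1 := (hm.strictAnti.antitoneOn self_mem_Ici hT hT).trans hm1
    have hw : ‖m T • p T‖ ≤ ‖p T‖ := by
      rw [norm_smul, Real.norm_of_nonneg (hm.pos T hT).le]
      exact mul_le_of_le_one_left (norm_nonneg _) hmT
    have hv : ‖position θ m q p T‖ ≤ ‖q T - θ‖ + ‖p T‖ := (norm_add_le _ _).trans (by gcongr)
    have hw2 := pow_le_pow_left₀ (norm_nonneg _) hw 2
    have hv2 := pow_le_pow_left₀ (norm_nonneg _) hv 2
    unfold energy
    nlinarith [sq_nonneg (‖q T - θ‖ - ‖p T‖), sq_nonneg ‖q T - θ‖]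
  · exact (((h.cont_q.sub continuousOn_const).norm.pow 2).add (h.cont_p.norm.pow 2)).mono
      Icc_subset_Ici_self
  · intro t ht
    exact ((h.deriv_q t ht.1).sub_const θ).norm_sq.add (h.deriv_p t ht.1).norm_sq
  · simp [h.init_q, h.init_p]
  · intro t ht
    have hmt : 0 < m t := hm.pos t ht.1
    have hinv : (m t)⁻¹ ≤ M :=
      inv_anti₀ (hm.pos T hT) (hm.strictAnti.antitoneOn ht.1 hT ht.2.le)
    have hinv0 : 0 ≤ (m t)⁻¹ := inv_nonneg.2 hmt.le
    have h1 := real_inner_le_norm (q t - θ) (p t)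
    have h2 : inner ℝ (p t) (-(b (y t) (q t)) - p t) ≤ ‖p t‖ * (G + L * ‖q t - θ‖) := by
      rw [inner_sub_right, inner_neg_right, real_inner_self_eq_norm_sq]
      have h3 := neg_le_of_abs_le (abs_real_inner_le_norm (p t) (b (y t) (q t)))
      have h4 := mul_le_mul_of_nonneg_left (hb.norm_le (y t) (q t)) (norm_nonneg (p t))
      nlinarith [sq_nonneg ‖p t‖]
    have h3 : (m t)⁻¹ * inner ℝ (p t) (-(b (y t) (q t)) - p t) ≤
        M * (‖p t‖ * (G + L * ‖q t - θ‖)) :=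
      (mul_le_mul_of_nonneg_left h2 hinv0).trans
        (mul_le_mul_of_nonneg_right hinv (by positivity))
    have h4 : 2 * (‖p t‖ * (G + L * ‖q t - θ‖)) ≤
        (‖p t‖ ^ 2 + G ^ 2) + L * (‖q t - θ‖ ^ 2 + ‖p t‖ ^ 2) := by
      nlinarith [sq_nonneg (‖p t‖ - G), mul_nonneg hL (sq_nonneg (‖p t‖ - ‖q t - θ‖))]
    have h5 := mul_le_mul_of_nonneg_left h4 hM0.le
    simp only [inner_smul_right]
    nlinarith [sq_nonneg (‖q t - θ‖ - ‖p t‖), mul_nonneg hM0.le (sq_nonneg ‖q t - θ‖)]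

/-- The inverse mass beyond which the energy is dissipated. -/
noncomputable def dissipationThreshold (L κ : ℝ) : ℝ :=
  κ + (4 * L + 2) ^ 2 / (2 * κ) + 3 + 2 * L

theorem eq_add_position_sub (θ : X K) (m : ℝ → ℝ) (q p : ℝ → X K) (t : ℝ) :
    q t = θ + position θ m q p t - m t • p t := by
  unfold position; abel

/-- A bound for the energy which is uniform in time and in the index path. -/
theorem IsDrift.exists_energy_bound (hκ : 0 < κ) (hb : IsDrift b L κ θ) (hm : IsMass m)
    (hslow : IsSlowMass (min (κ / 4) (1 / 4)) m) (q₀ p₀ : X K) {T : ℝ} (hT : 0 < T)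
    (hTm : ∀ t, T ≤ t → dissipationThreshold L κ ≤ (m t)⁻¹) :
    ∃ B, 0 ≤ B ∧ ∀ (y : ℝ → Fin N) (q p : ℝ → X K), IsMomentumPath b m y q₀ p₀ q p →
      ∀ t, T ≤ t → energy θ m q p t ≤ B ^ 2 := by
  obtain ⟨D, hD⟩ := hb.exists_energy_le hm hslow.2 q₀ p₀ hT.le
  have hL := hb.nonneg
  set G := driftBound b θ
  have hG : 0 ≤ G := driftBound_nonneg b θ
  set C := 2 * G ^ 2 / κ + G ^ 2
  have hC : 0 ≤ C := by positivity
  -- Grönwall with rate `-κ` bounds the energy by its value at `T` plus `C / κ`.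
  refine ⟨√(|D| + C / κ), Real.sqrt_nonneg _, fun y q p h t ht => ?_⟩
  rw [Real.sq_sqrt (by positivity)]
  have key := le_gronwallBound_of_hasDerivWithinAt (δ := |D|) (A := -κ) (ε := C) (a := T) (c := t)
    ((h.continuousOn_energy hm (θ := θ)).mono fun s hs => (hT.le.trans hs.1 : (0 : ℝ) ≤ s))
    (fun s hs => h.hasDerivWithinAt_energy hm (hT.trans_le hs.1))
    ((hD y q p h).trans (le_abs_self D)) ?_ t (right_mem_Icc.2 ht)
  · refine key.trans ?_
    rw [gronwallBound_of_K_ne_0 (neg_ne_zero.2 hκ.ne')]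
    have h1 : Real.exp (-κ * (t - T)) ≤ 1 := Real.exp_le_one_iff.2 (by nlinarith)
    have h0 := Real.exp_pos (-κ * (t - T))
    have h2 : C / -κ * (Real.exp (-κ * (t - T)) - 1) = C / κ * (1 - Real.exp (-κ * (t - T))) := by
      rw [div_neg]; ring
    simp only [h2]
    have h3 : 0 ≤ C / κ := by positivity
    nlinarith [abs_nonneg D]
  · intro s hs
    have hs0 : 0 < s := hT.trans_le hs.1
    set v := position θ m q p s
    set w := m s • p s
    have h1 := hb.energy_rate_le (y s) (v := v) (w := w) (x := q s) (c := (m s)⁻¹)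
      (abs_massRate_le hm hslow hs0) (eq_add_position_sub θ m q p s)
    refine h1.trans ?_
    have h2 : κ * ‖v‖ ^ 2 - G * ‖v‖ ≤ inner ℝ v (b (y s) (θ + v)) := by
      have h3 := hb.monotone (y s) (θ + v) θ
      rw [add_sub_cancel_left, inner_sub_right] at h3
      have h4 := neg_le_of_abs_le (abs_real_inner_le_norm v (b (y s) θ))
      have h5 := mul_le_mul_of_nonneg_left (norm_drift_le b θ (y s)) (norm_nonneg v)
      linarith
    -- Of the dissipation `2κ‖v‖²`, one `κ` is kept for the decay and the two halves of the other
    -- absorb `2G‖v‖` and the cross term.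
    have h3 : 2 * G * ‖v‖ ≤ κ / 2 * ‖v‖ ^ 2 + 2 * G ^ 2 / κ := by
      have h : κ / 2 * ‖v‖ ^ 2 + 2 * G ^ 2 / κ - 2 * G * ‖v‖ = (κ * ‖v‖ - 2 * G) ^ 2 / (2 * κ) := by
        field_simp; ring
      have : 0 ≤ (κ * ‖v‖ - 2 * G) ^ 2 / (2 * κ) := by positivity
      linarith
    have h4 : (4 * L + 2) * (‖v‖ * ‖w‖) ≤
        κ / 2 * ‖v‖ ^ 2 + (4 * L + 2) ^ 2 / (2 * κ) * ‖w‖ ^ 2 := by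
      have h : κ / 2 * ‖v‖ ^ 2 + (4 * L + 2) ^ 2 / (2 * κ) * ‖w‖ ^ 2 - (4 * L + 2) * (‖v‖ * ‖w‖) =
          (κ * ‖v‖ - (4 * L + 2) * ‖w‖) ^ 2 / (2 * κ) := by
        field_simp; ring
      have : 0 ≤ (κ * ‖v‖ - (4 * L + 2) * ‖w‖) ^ 2 / (2 * κ) := by positivity
      linarith
    have h5 : 2 * G * ‖w‖ ≤ ‖w‖ ^ 2 + G ^ 2 := by nlinarith [sq_nonneg (‖w‖ - G)]
    -- `dissipationThreshold` collects the coefficients of `‖w‖²`: `κ` for the decay, the cost of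
    -- the cross term, `1` from `2G‖w‖`, and `2L + 2`.
    have hR := mul_le_mul_of_nonneg_right (hTm s hs.1) (sq_nonneg ‖w‖)
    have hR0 : 0 ≤ (m s)⁻¹ * ‖w‖ ^ 2 :=
      mul_nonneg (inv_nonneg.2 (hm.pos s hs0.le).le) (sq_nonneg _)
    unfold dissipationThreshold at hR
    show _ ≤ -κ * (‖v‖ ^ 2 + ‖w‖ ^ 2) + C
    simp only [C]
    nlinarith

/-- The energy balance in terms of the fluctuation of the drift. -/
theorem IsDrift.energy_rate_le_fluctuation (hN : 1 ≤ N) (hκ : 0 < κ) (hb : IsDrift b L κ θ)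
    (j : Fin N) {v w x : X K} {a M B : ℝ} (ha : |a| ≤ 1) (hx : x = θ + v - w) (hM : 0 < M)
    (hMinv : dissipationThreshold L κ ≤ M⁻¹) (hv : ‖v‖ ≤ B) (hw : ‖w‖ ≤ B) :
    2 * inner ℝ v (a • w - b j x) + 2 * inner ℝ w (a • w - b j x - M⁻¹ • w) ≤
      -κ * (‖v‖ ^ 2 + ‖w‖ ^ 2) + fluctuation b θ j v +
        ((6 * L + 4) * B + 2 * driftBound b θ) ^ 2 / 4 * M := by
  have hL := hb.nonneg
  have h1 := hb.energy_rate_le j (c := M⁻¹) ha hx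
  have h2 := hb.avgDrift_monotone hN v
  have h3 : fluctuation b θ j v =
      2 * inner ℝ v (avgDrift b (θ + v)) - 2 * inner ℝ v (b j (θ + v)) := by
    rw [fluctuation, inner_sub_right]; ring
  set G := driftBound b θ
  set C := (6 * L + 4) * B + 2 * G
  have h4 : (4 * L + 2) * (‖v‖ * ‖w‖) + 2 * G * ‖w‖ + (2 * L + 2) * ‖w‖ ^ 2 ≤ C * ‖w‖ := by
    have h5 : ‖v‖ * ‖w‖ ≤ B * ‖w‖ := by gcongr
    have h6 : ‖w‖ ^ 2 ≤ B * ‖w‖ := by rw [sq]; gcongr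
    have h7 := mul_le_mul_of_nonneg_left h5 (show 0 ≤ 4 * L + 2 by linarith)
    have h8 := mul_le_mul_of_nonneg_left h6 (show 0 ≤ 2 * L + 2 by linarith)
    simp only [C]
    linarith
  -- One of the two copies of `M⁻¹‖w‖²` absorbs the linear term at a cost proportional to the mass;
  -- the other supplies the decay of `w`.
  have h5 : C * ‖w‖ ≤ M⁻¹ * ‖w‖ ^ 2 + C ^ 2 / 4 * M := by
    have h : M⁻¹ * ‖w‖ ^ 2 + C ^ 2 / 4 * M - C * ‖w‖ = (‖w‖ - C / 2 * M) ^ 2 / M := by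
      field_simp; ring
    have : 0 ≤ (‖w‖ - C / 2 * M) ^ 2 / M := by positivity
    linarith
  have h6 : κ * ‖w‖ ^ 2 ≤ M⁻¹ * ‖w‖ ^ 2 := by
    refine mul_le_mul_of_nonneg_right (le_trans ?_ hMinv) (sq_nonneg _)
    unfold dissipationThreshold
    have : 0 ≤ (4 * L + 2) ^ 2 / (2 * κ) := by positivity
    linarith
  have h7 : 0 ≤ κ * ‖v‖ ^ 2 := by positivity
  linarith

/-- Over a short time window, the energy contracts up to the excess occupation times. -/
theorem IsDrift.exists_window_bound (hN : 1 ≤ N) (hκ : 0 < κ) (hb : IsDrift b L κ θ)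
    (hm : IsMass m) (hslow : IsSlowMass (min (κ / 4) (1 / 4)) m) {T B : ℝ} (hT : 0 < T)
    (hB : 0 ≤ B) (hTm : ∀ t, T ≤ t → dissipationThreshold L κ ≤ (m t)⁻¹) (q₀ p₀ : X K) :
    ∃ C, 0 ≤ C ∧ ∀ (y : ℝ → Fin N) (q p : ℝ → X K),
      (∀ t, 0 ≤ t → ∀ᶠ s in 𝓝[>] t, y s = y t) → IsMomentumPath b m y q₀ p₀ q p →
      (∀ t, T ≤ t → energy θ m q p t ≤ B ^ 2) → ∀ a δ, T ≤ a → 0 < δ → δ ≤ 1 →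
      energy θ m q p (a + δ) ≤ Real.exp (-κ * δ) * energy θ m q p a +
        C * (∑ j, |occupation y j a (a + δ)| + δ ^ 2 + m a) := by
  have hL := hb.nonneg
  set G := driftBound b θ
  have hG : 0 ≤ G := driftBound_nonneg b θ
  -- bounds for the velocity, the fluctuation, its Lipschitz constant and the mass term
  set Cv := B + (G + L * (B + B))
  set Cf := 2 * B * (G + 2 * L * B)
  set Cl := 2 * G + 8 * L * B
  set Cm := ((6 * L + 4) * B + 2 * G) ^ 2 / 4
  have hCv : 0 ≤ Cv := by positivity
  have hCf : 0 ≤ Cf := by positivity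
  have hCl : 0 ≤ Cl := by positivity
  have hCm : 0 ≤ Cm := by positivity
  set e := Real.exp κ
  have he : 0 < e := Real.exp_pos κ
  -- `Cf` multiplies the occupation times, `κ e Cf` pays for replacing the weight `exp (κ(s - a))`
  -- by `1`, `Cl Cv` for freezing `v`, and `e Cm` for the mass term. None depends on the path, on
  -- `a` or on `δ`.
  refine ⟨Cf + (κ * e * Cf + Cl * Cv) + e * Cm, by positivity, ?_⟩
  intro y q p hy h hE a δ haT hδ hδ1
  have ha0 : 0 < a := hT.trans_le haT
  have hEB : ∀ t, T ≤ t → ‖position θ m q p t‖ ≤ B ∧ ‖m t • p t‖ ≤ B := by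
    intro t ht
    have h1 := hE t ht
    unfold energy at h1
    constructor <;> refine le_of_sq_le_sq ?_ hB <;>
      nlinarith [sq_nonneg ‖position θ m q p t‖, sq_nonneg ‖m t • p t‖]
  set va := position θ m q p a
  -- the velocity of the corrected position is bounded
  have hvel : ∀ s ∈ Icc a (a + δ), ‖position θ m q p s - va‖ ≤ Cv * (s - a) := by
    refine norm_image_sub_le_of_norm_deriv_right_le_segment
      ((h.continuousOn_position hm).mono fun s hs => (ha0.le.trans hs.1 : (0 : ℝ) ≤ s))
      (fun s hs => h.hasDerivWithinAt_position hm (ha0.trans_le hs.1)) fun s hs => ?_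
    have hs0 : 0 < s := ha0.trans_le hs.1
    obtain ⟨h1, h2⟩ := hEB s (haT.trans hs.1)
    have h3 := abs_massRate_le hm hslow hs0
    have h4 : ‖massRate m s • (m s • p s)‖ ≤ B := by
      rw [norm_smul, Real.norm_eq_abs]
      exact (mul_le_of_le_one_left (norm_nonneg _) h3).trans h2
    have h5 : ‖q s - θ‖ ≤ B + B := by
      have : q s - θ = position θ m q p s - m s • p s := by unfold position; abel
      rw [this]
      exact (norm_sub_le _ _).trans (add_le_add h1 h2)
    have h6 : ‖b (y s) (q s)‖ ≤ G + L * (B + B) :=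
      (hb.norm_le (y s) (q s)).trans (by gcongr)
    exact (norm_sub_le _ _).trans (add_le_add h4 h6)
  -- The weighted energy is compared with the integral of the frozen fluctuation plus a linear error
  -- term; the weight `exp (κ(s - a))` cancels the dissipation `-κ E`.
  have hcmp := image_le_of_deriv_right_le_deriv_boundary
    (f := fun s => Real.exp (κ * (s - a)) * energy θ m q p s)
    (f' := fun s => Real.exp (κ * (s - a)) * κ * energy θ m q p s + Real.exp (κ * (s - a)) *
      (2 * inner ℝ (position θ m q p s) (massRate m s • (m s • p s) - b (y s) (q s)) +
        2 * inner ℝ (m s • p s)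
          (massRate m s • (m s • p s) - b (y s) (q s) - (m s)⁻¹ • (m s • p s))))
    (B := fun s => energy θ m q p a + (∑ j, fluctuation b θ j va * occupation y j a s +
      ((κ * e * Cf + Cl * Cv) * δ + e * Cm * m a) * (s - a)))
    (B' := fun s => ∑ j, fluctuation b θ j va * centredIndicator j (y s) +
      ((κ * e * Cf + Cl * Cv) * δ + e * Cm * m a))
    (a := a) (b := a + δ) ?_ ?_ ?_ ?_ ?_ ?_ (right_mem_Icc.2 (by linarith))
  · simp only [add_sub_cancel_left] at hcmp
    have hexp : Real.exp (-κ * δ) * Real.exp (κ * δ) = 1 := by rw [← Real.exp_add]; simp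
    have hle1 : Real.exp (-κ * δ) ≤ 1 := Real.exp_le_one_iff.2 (by nlinarith)
    have hpos := Real.exp_pos (-κ * δ)
    have hma : 0 < m a := hm.pos a ha0.le
    have hsum : ∑ j, fluctuation b θ j va * occupation y j a (a + δ) ≤
        Cf * ∑ j, |occupation y j a (a + δ)| := by
      rw [Finset.mul_sum]
      refine Finset.sum_le_sum fun j _ => (le_abs_self _).trans ?_
      rw [abs_mul]
      exact mul_le_mul_of_nonneg_right (hb.abs_fluctuation_le hN j (hEB a haT).1) (abs_nonneg _)
    set S := ∑ j, |occupation y j a (a + δ)|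
    have hS : 0 ≤ S := Finset.sum_nonneg fun _ _ => abs_nonneg _
    have h1 := mul_le_mul_of_nonneg_left hcmp hpos.le
    rw [← mul_assoc, hexp, one_mul, mul_add] at h1
    refine h1.trans (add_le_add le_rfl ?_)
    set R := κ * e * Cf + Cl * Cv
    have hR : 0 ≤ R := by positivity
    have hQ : 0 ≤ e * Cm := by positivity
    have h2 : ∑ j, fluctuation b θ j va * occupation y j a (a + δ) +
        (R * δ + e * Cm * m a) * δ ≤ Cf * S + R * δ ^ 2 + e * Cm * m a := by
      have : e * Cm * m a * δ ≤ e * Cm * m a := mul_le_of_le_one_right (by positivity) hδ1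
      nlinarith
    have h3 : Cf * S + R * δ ^ 2 + e * Cm * m a ≤ (Cf + R + e * Cm) * (S + δ ^ 2 + m a) := by
      have k1 : 0 ≤ Cf * (δ ^ 2 + m a) := by positivity
      have k2 : 0 ≤ R * (S + m a) := by positivity
      have k3 : 0 ≤ e * Cm * (S + δ ^ 2) := by positivity
      nlinarith
    refine (mul_le_mul_of_nonneg_left (h2.trans h3) hpos.le).trans ?_
    exact mul_le_of_le_one_left (by positivity) hle1
  · refine ContinuousOn.mul (by fun_prop) ?_
    exact (h.continuousOn_energy hm).mono fun s hs => (ha0.le.trans hs.1 : (0 : ℝ) ≤ s)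
  · intro s hs
    have h1 : HasDerivWithinAt (fun s => Real.exp (κ * (s - a))) (Real.exp (κ * (s - a)) * κ)
        (Ici s) s := by
      refine HasDerivWithinAt.exp ?_
      simpa using ((hasDerivWithinAt_id s (Ici s)).sub_const a).const_mul κ
    exact h1.mul (h.hasDerivWithinAt_energy hm (ha0.trans_le hs.1))
  · simp [occupation]
  · refine continuousOn_const.add (ContinuousOn.add ?_ (by fun_prop))
    refine continuousOn_finsetSum _ fun j _ => continuousOn_const.mul ?_
    exact continuousOn_occupation hN hy j ha0.le (by linarith)
  · intro s hs
    refine HasDerivWithinAt.const_add _ (HasDerivWithinAt.add ?_ ?_)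
    · exact HasDerivWithinAt.fun_sum fun j _ =>
        (hasDerivWithinAt_occupation hN hy j ha0.le hs.1).const_mul _
    · simpa using ((hasDerivWithinAt_id s (Ici s)).sub_const a).const_mul
        ((κ * e * Cf + Cl * Cv) * δ + e * Cm * m a)
  · intro s hs
    have hs0 : 0 < s := ha0.trans_le hs.1
    obtain ⟨h1, h2⟩ := hEB s (haT.trans hs.1)
    have h3 := hb.energy_rate_le_fluctuation hN hκ (y s) (abs_massRate_le hm hslow hs0)
      (eq_add_position_sub θ m q p s) (hm.pos s hs0.le) (hTm s (haT.trans hs.1))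
      h1 h2
    rw [← fluctuation_eq_sum hN]
    have hms : m s ≤ m a := hm.strictAnti.antitoneOn ha0.le hs0.le hs.1
    have hma : 0 < m a := hm.pos a ha0.le
    have hms0 : 0 < m s := hm.pos s hs0.le
    have hsδ : s - a ≤ δ := by linarith [hs.2]
    have hsa : 0 ≤ s - a := by linarith [hs.1]
    set E := Real.exp (κ * (s - a))
    have hE0 : 0 < E := Real.exp_pos _
    have hEe : E ≤ e := Real.exp_le_exp.2 (by nlinarith)
    have hE1 : E - 1 ≤ κ * e * δ := by
      have k1 : 1 - κ * (s - a) ≤ E⁻¹ := by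
        rw [← Real.exp_neg]
        have := Real.add_one_le_exp (-(κ * (s - a)))
        linarith
      have k2 := mul_le_mul_of_nonneg_left k1 hE0.le
      rw [mul_inv_cancel₀ hE0.ne'] at k2
      have k3 : E * (κ * (s - a)) ≤ e * (κ * δ) := by gcongr
      linarith
    have hE1' : 1 ≤ E := Real.one_le_exp (by positivity)
    set v := position θ m q p s
    have hf1 := hb.abs_fluctuation_le hN (y s) h1
    have hf2 := hb.abs_fluctuation_sub_le hN (y s) h1 (hEB a haT).1
    have hf3 : Cl * ‖v - va‖ ≤ Cl * (Cv * δ) := by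
      refine mul_le_mul_of_nonneg_left ((hvel s ⟨hs.1, hs.2.le⟩).trans ?_) hCl
      gcongr
    have hg1 : (E - 1) * fluctuation b θ (y s) v ≤ κ * e * δ * Cf := by
      refine (mul_le_mul_of_nonneg_left ((le_abs_self _).trans hf1) (by linarith)).trans ?_
      exact mul_le_mul_of_nonneg_right hE1 hCf
    have hg2 : fluctuation b θ (y s) v - fluctuation b θ (y s) va ≤ Cl * (Cv * δ) :=
      (le_abs_self _).trans (hf2.trans hf3)
    have hg3 : E * (Cm * m s) ≤ e * (Cm * m a) := by gcongr
    have hg4 : E * _ ≤ E * (-κ * (‖v‖ ^ 2 + ‖m s • p s‖ ^ 2) + fluctuation b θ (y s) v + Cm * m s) :=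
      mul_le_mul_of_nonneg_left h3 hE0.le
    have hen : energy θ m q p s = ‖v‖ ^ 2 + ‖m s • p s‖ ^ 2 := rfl
    rw [hen]
    linarith

end Path

end Dynamics

/-! ### From window contraction to convergence. -/

/-- A bounded function which contracts over every short time window, up to errors of second order
in the window length and errors which vanish at infinity, tends to zero. -/
theorem tendsto_zero_of_window_contraction {e : ℝ → ℝ} {B T κ C : ℝ} (hκ : 0 < κ) (hC : 0 ≤ C)
    (he : ∀ t, 0 ≤ e t) (hB : ∀ t, T ≤ t → e t ≤ B)
    (hwin : ∀ δ, 0 < δ → δ ≤ 1 → ∃ η : ℝ → ℝ, Tendsto η atTop (𝓝 0) ∧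
      ∀ t, T ≤ t → e (t + δ) ≤ Real.exp (-κ * δ) * e t + C * δ ^ 2 + η t) :
    Tendsto e atTop (𝓝 0) := by
  rw [Metric.tendsto_nhds]
  intro ε hε
  -- Since `1 - exp (-κδ) ≥ κδ / (1 + κ)` for `δ ≤ 1`, this choice makes the limiting level `D`
  -- below at most `ε / 2`.
  set δ := min 1 (ε * κ / (2 * (C + 1) * (1 + κ)))
  have hδ : 0 < δ := lt_min one_pos (by positivity)
  have hδ1 : δ ≤ 1 := min_le_left _ _
  have hδ2 : δ ≤ ε * κ / (2 * (C + 1) * (1 + κ)) := min_le_right _ _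
  obtain ⟨η, hη, hstep⟩ := hwin δ hδ hδ1
  set ρ := Real.exp (-κ * δ)
  have hρ0 : 0 < ρ := Real.exp_pos _
  have hρ : κ * δ ≤ (1 - ρ) * (1 + κ) := by
    have h1 : ρ * (1 + κ * δ) ≤ 1 := by
      have h2 := mul_le_mul_of_nonneg_left (Real.add_one_le_exp (κ * δ)) hρ0.le
      rw [← Real.exp_add, neg_mul, neg_add_cancel, Real.exp_zero] at h2
      linarith
    have h3 : ρ ≤ 1 := Real.exp_le_one_iff.2 (by nlinarith)
    nlinarith [mul_nonneg (sub_nonneg.2 h3) (mul_nonneg hκ.le (sub_nonneg.2 hδ1))]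
  have hρ1 : 0 < 1 - ρ := by
    have : 0 < (1 - ρ) * (1 + κ) := lt_of_lt_of_le (by positivity) hρ
    exact pos_of_mul_pos_left this (by positivity)
  -- The fixed point of `x ↦ ρ x + (C + 1) δ²`; the extra `1` absorbs `η`, which is eventually below
  -- `δ²`.
  set D := (C + 1) * δ ^ 2 / (1 - ρ)
  have hD : D ≤ ε / 2 := by
    rw [div_le_iff₀ hρ1]
    rw [le_div_iff₀ (by positivity)] at hδ2
    have h1 := mul_le_mul_of_nonneg_right hδ2 hδ.le
    have h2 := mul_le_mul_of_nonneg_left hρ hε.le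
    have h3 : 0 < 1 + κ := by linarith
    refine le_of_mul_le_mul_right ?_ h3
    nlinarith
  have hρD : ρ * D + (C + 1) * δ ^ 2 = D := by
    simp only [D]
    field_simp
    ring
  have hiter : ∀ n : ℕ, ∀ᶠ t in atTop, e t ≤ D + ρ ^ n * B := by
    intro n
    induction n with
    | zero =>
      filter_upwards [eventually_ge_atTop T] with t ht
      have hD0 : 0 ≤ D := by positivity
      linarith [hB t ht]
    | succ n ih =>
      have hev : ∀ᶠ t in atTop, e (t + δ) ≤ D + ρ ^ (n + 1) * B := by
        filter_upwards [ih, eventually_ge_atTop T,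
          hη.eventually (gt_mem_nhds (show 0 < δ ^ 2 by positivity))] with t h1 h2 h3
        have h4 := hstep t h2
        have h5 := mul_le_mul_of_nonneg_left h1 hρ0.le
        rw [pow_succ]
        linarith
      have hsub : Tendsto (fun t : ℝ => t - δ) atTop atTop :=
        tendsto_atTop_add_const_right _ _ tendsto_id
      filter_upwards [hsub.eventually hev] with t ht
      rwa [sub_add_cancel] at ht
  have hpow : Tendsto (fun n : ℕ => ρ ^ n * B) atTop (𝓝 0) := by
    simpa using (tendsto_pow_atTop_nhds_zero_of_lt_one hρ0.le (by linarith)).mul_const B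
  obtain ⟨n, hn⟩ := (hpow.eventually (gt_mem_nhds (half_pos hε))).exists
  filter_upwards [hiter n] with t ht
  rw [Real.dist_eq, sub_zero, abs_of_nonneg (he t)]
  linarith

/-! ### Decay of the mean energy. -/

section MeanEnergy

variable {Ω : Type*} [MeasurableSpace Ω] {P : Measure Ω} {N K : ℕ} {γ κ : ℝ}
  {Φ : Fin N → X K → ℝ} {L : ℝ≥0} {m μ : ℝ → ℝ} {i : ℝ → Ω → Fin N} {q₀ p₀ θ : X K}
  {q p : ℝ → Ω → X K}

theorem IsDDSGMP.ae_isMomentumPath (h : IsDDSGMP P Φ m μ i q₀ p₀ q p) :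
    ∀ᵐ ω ∂P, IsMomentumPath (fun j => ∇ (Φ j)) m (fun t => rescaled μ i t ω) q₀ p₀
      (fun t => q t ω) (fun t => p t ω) := by
  filter_upwards [h.cont_q, h.cont_p, h.init_q, h.init_p, h.deriv_q, h.deriv_p]
    with ω h1 h2 h3 h4 h5 h6
  exact ⟨h1, h2, h3, h4, h5, h6⟩

theorem IsDDSGMP.measurable_energy (h : IsDDSGMP P Φ m μ i q₀ p₀ q p) (θ : X K) {t : ℝ}
    (ht : 0 ≤ t) :
    Measurable fun ω => energy θ m (fun t => q t ω) (fun t => p t ω) t := by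
  have hq := h.measurable_q t ht
  have hp := h.measurable_p t ht
  unfold energy position
  fun_prop

theorem isDrift_gradient (hΦ : ∀ j, IsC1LipschitzGradient L (Φ j))
    (hconv : ∀ j, IsStronglyConvexWith κ (Φ j)) (hθ : ∑ j, ∇ (Φ j) θ = 0) :
    IsDrift (fun j => ∇ (Φ j)) L κ θ :=
  ⟨L.2, fun j x z => (hΦ j).2.norm_sub_le x z, fun j x z => hconv j x z, hθ⟩

theorem IsMass.exists_threshold (hm : IsMass m) (R : ℝ) :
    ∃ T, 0 < T ∧ ∀ t, T ≤ t → R ≤ (m t)⁻¹ := by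
  have h : Tendsto (fun t => (m t)⁻¹) atTop atTop := by
    refine tendsto_inv_nhdsGT_zero.comp (tendsto_nhdsWithin_iff.2 ⟨hm.tendsto_zero, ?_⟩)
    filter_upwards [eventually_ge_atTop 0] with t ht
    exact hm.pos t ht
  obtain ⟨T, hT⟩ := eventually_atTop.1 (h.eventually_ge_atTop R)
  exact ⟨max T 1, by positivity, fun t ht => hT t ((le_max_left _ _).trans ht)⟩

/-- The mean energy of the process vanishes in the long run. -/
theorem IsDDSGMP.tendsto_integral_energy [IsProbabilityMeasure P] (hN : 1 ≤ N) (hγ : 0 < γ)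
    (hκ : 0 < κ) (hΦ : ∀ j, IsC1LipschitzGradient L (Φ j))
    (hconv : ∀ j, IsStronglyConvexWith κ (Φ j)) (hθ : ∑ j, ∇ (Φ j) θ = 0) (hm : IsMass m)
    (hslow : IsSlowMass (min (κ / 4) (1 / 4)) m) (hμ : IsSpeed μ)
    (hμ_top : Tendsto μ atTop atTop) (hi : IsIndexProcess P γ i)
    (h : IsDDSGMP P Φ m μ i q₀ p₀ q p) :
    (∀ᶠ t in atTop,
      Integrable (fun ω => energy θ m (fun t => q t ω) (fun t => p t ω) t) P) ∧
    Tendsto (fun t => ∫ ω, energy θ m (fun t => q t ω) (fun t => p t ω) t ∂P) atTop (𝓝 0) := by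
  have hb := isDrift_gradient hΦ hconv hθ
  obtain ⟨T, hT, hTm⟩ := hm.exists_threshold (dissipationThreshold L κ)
  obtain ⟨B, hB, hbound⟩ := hb.exists_energy_bound hκ hm hslow q₀ p₀ hT hTm
  obtain ⟨C, hC, hwin⟩ := hb.exists_window_bound hN hκ hm hslow hT hB hTm q₀ p₀
  have hae : ∀ᵐ ω ∂P, ∀ t, T ≤ t →
      energy θ m (fun t => q t ω) (fun t => p t ω) t ≤ B ^ 2 := by
    filter_upwards [h.ae_isMomentumPath] with ω hω t ht
    exact hbound _ _ _ hω t ht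
  have hInt : ∀ t, T ≤ t →
      Integrable (fun ω => energy θ m (fun t => q t ω) (fun t => p t ω) t) P := by
    intro t ht
    refine Integrable.of_bound (C := B ^ 2)
      (h.measurable_energy θ (hT.le.trans ht)).aestronglyMeasurable ?_
    filter_upwards [hae] with ω hω
    rw [Real.norm_of_nonneg (energy_nonneg _ _ _ _ _)]
    exact hω t ht
  refine ⟨(eventually_ge_atTop T).mono hInt, ?_⟩
  refine tendsto_zero_of_window_contraction (B := B ^ 2) (T := T) (C := C * (N + 1)) hκ
    (by positivity) (fun t => integral_nonneg fun ω => energy_nonneg _ _ _ _ _) ?_ ?_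
  · intro t ht
    refine (integral_mono_ae (hInt t ht) (integrable_const (B ^ 2)) ?_).trans (by simp)
    filter_upwards [hae] with ω hω using hω t ht
  · intro δ hδ hδ1
    set O : Fin N → ℝ → Ω → ℝ := fun j t ω => occupation (fun s => rescaled μ i s ω) j t (t + δ)
    -- The bound `|O| ≤ O² / δ² + δ²` trades first moments for second moments. Its `N` copies of
    -- `δ²`, with the one from the window bound, give the constant `C * (N + 1)`.
    refine ⟨fun t => C * (∑ j, (∫ ω, O j t ω ^ 2 ∂P) / δ ^ 2 + m t), ?_, ?_⟩
    · have h1 : Tendsto (fun t => C * (∑ j, (∫ ω, O j t ω ^ 2 ∂P) / δ ^ 2 + m t)) atTop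
          (𝓝 (C * (∑ _j : Fin N, (0 : ℝ) / δ ^ 2 + 0))) :=
        ((tendsto_finsetSum _ fun j _ =>
          (hi.tendsto_integral_occupation_sq hN hγ hμ hμ_top j hδ.le).div_const _).add
            hm.tendsto_zero).const_mul C
      simpa using h1
    · intro t ht
      have ht0 : 0 ≤ t := hT.le.trans ht
      have hO : ∀ j, Integrable (fun ω => O j t ω ^ 2) P := by
        intro j
        refine Integrable.of_bound (C := 1)
          ((hi.aestronglyMeasurable_occupation hμ j ht0 hδ.le).pow 2) ?_
        refine Eventually.of_forall fun ω => ?_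
        have h1 := abs_occupation_le hN (fun s => rescaled μ i s ω) j
          (show t ≤ t + δ by linarith)
        rw [Real.norm_of_nonneg (sq_nonneg _), ← sq_abs]
        exact pow_le_one₀ (abs_nonneg _) (h1.trans (by linarith))
      have hOsum : Integrable (fun ω => ∑ j, O j t ω ^ 2 / δ ^ 2) P :=
        integrable_finsetSum _ fun j _ => (hO j).div_const _
      have hOadd : Integrable
          (fun ω => C * (∑ j, O j t ω ^ 2 / δ ^ 2 + ((N + 1) * δ ^ 2 + m t))) P :=
        (hOsum.add (integrable_const _)).const_mul C
      have hrhs : Integrable (fun ω => Real.exp (-κ * δ) *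
          energy θ m (fun t => q t ω) (fun t => p t ω) t +
          C * (∑ j, O j t ω ^ 2 / δ ^ 2 + ((N + 1) * δ ^ 2 + m t))) P :=
        ((hInt t ht).const_mul _).add hOadd
      have hle := integral_mono_ae (hInt (t + δ) (by linarith)) hrhs (by
        filter_upwards [h.ae_isMomentumPath, hi.rescaled_right_cont hμ, hae] with ω h1 h2 h3
        refine (hwin _ _ _ h2 h1 h3 t δ ht hδ hδ1).trans (add_le_add le_rfl ?_)
        refine mul_le_mul_of_nonneg_left ?_ hC
        have h4 : ∑ j, |O j t ω| ≤ ∑ j, (O j t ω ^ 2 / δ ^ 2 + δ ^ 2) := by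
          refine Finset.sum_le_sum fun j _ => ?_
          have h5 : O j t ω ^ 2 / δ ^ 2 + δ ^ 2 - 2 * |O j t ω| =
              (|O j t ω| - δ ^ 2) ^ 2 / δ ^ 2 := by
            rw [← sq_abs (O j t ω)]
            field_simp
            ring
          have h6 : 0 ≤ (|O j t ω| - δ ^ 2) ^ 2 / δ ^ 2 := by positivity
          linarith [abs_nonneg (O j t ω)]
        rw [Finset.sum_add_distrib, Finset.sum_const, Finset.card_univ, Fintype.card_fin,
          nsmul_eq_mul] at h4
        linarith)
      refine hle.trans (le_of_eq ?_)
      rw [integral_add ((hInt t ht).const_mul _) hOadd,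
        integral_const_mul, integral_const_mul, integral_add hOsum (integrable_const _),
        integral_finsetSum _ fun j _ => (hO j).div_const _]
      simp_rw [integral_div]
      simp
      ring

end MeanEnergy

end SGMP

/-! ### Convergence in probability. -/

theorem mainTheorem2 {Ω : Type*} [MeasurableSpace Ω] (P : Measure Ω) [IsProbabilityMeasure P]
    (N K : ℕ) (hN : 1 ≤ N) (γ : ℝ) (hγ : 0 < γ)
    (Φ : Fin N → SGMP.X K → ℝ) (L : ℝ≥0) (κ : ℝ) (hκ : 0 < κ)
    (hΦ : ∀ j, SGMP.IsC1LipschitzGradient L (Φ j))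
    (hconv : ∀ j, SGMP.IsStronglyConvexWith κ (Φ j))
    (m : ℝ → ℝ) (hm : SGMP.IsMass m) (hslow : SGMP.IsSlowMass (min (κ / 4) (1 / 4)) m)
    (μ : ℝ → ℝ) (hμ : SGMP.IsSpeed μ) (hμ_top : Tendsto μ atTop atTop)
    (i : ℝ → Ω → Fin N) (hi : SGMP.IsIndexProcess P γ i)
    (hgrowth : SGMP.GrowthCondition P κ m μ i)
    (q₀ p₀ : SGMP.X K) (q p : ℝ → Ω → SGMP.X K)
    (hqp : SGMP.IsDDSGMP P Φ m μ i q₀ p₀ q p) :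
    ∃ θ : SGMP.X K,
      (∀ x, SGMP.avgPotential Φ θ ≤ SGMP.avgPotential Φ x) ∧
      (∀ y, (∀ x, SGMP.avgPotential Φ y ≤ SGMP.avgPotential Φ x) → y = θ) ∧
      TendstoInMeasure P q atTop (fun _ => θ) := by
  obtain ⟨θ, hθ, hmin, huniq⟩ := SGMP.exists_unique_minimiser_avgPotential hN hκ hΦ hconv
  refine ⟨θ, hmin, huniq, ?_⟩
  obtain ⟨hInt, hlim⟩ := hqp.tendsto_integral_energy hN hγ hκ hΦ hconv hθ hm hslow hμ hμ_top hi
  rw [tendstoInMeasure_iff_measureReal_norm]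
  intro ε hε
  have hup := hlim.const_mul (2 / ε ^ 2)
  rw [mul_zero] at hup
  refine squeeze_zero' (Eventually.of_forall fun t => measureReal_nonneg) ?_ hup
  filter_upwards [hInt] with t ht
  -- The level is `ε² / 2` because `‖q - θ‖²` is at most twice the energy.
  have hmarkov := mul_meas_ge_le_integral_of_nonneg
    (Eventually.of_forall fun ω => SGMP.energy_nonneg θ m (fun t => q t ω) (fun t => p t ω) t)
    ht (ε ^ 2 / 2)
  have hsub : P.real {ω | ε ≤ ‖q t ω - θ‖} ≤
      P.real {ω | ε ^ 2 / 2 ≤ SGMP.energy θ m (fun t => q t ω) (fun t => p t ω) t} := by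
    refine measureReal_mono fun ω hω => ?_
    have h1 := SGMP.norm_sub_sq_le_energy θ m (fun t => q t ω) (fun t => p t ω) t
    have h2 := pow_le_pow_left₀ hε.le (show ε ≤ ‖q t ω - θ‖ from hω) 2
    show ε ^ 2 / 2 ≤ _
    linarith
  refine hsub.trans ?_
  rw [div_mul_eq_mul_div, le_div_iff₀ (by positivity)]
  linarith
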